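/- Let $p$ be a prime, $q$ a power of $p$, and let $\mathbb{F}_q(t)\langle\partial\rangle$ be the ring of linear differential operators $\sum_i f_i\partial^i$ with $f_i\in\mathbb{F}_q(t)$ and multiplication determined by $\partial f=f\partial+\frac{\mathrm{d}f}{\mathrm{d}t}$. Let $N\in\mathbb{F}_q(t^p)[Y]$ be monic, irreducible and separable over $\mathbb{F}_q(t^p)$, let $K_N=\mathbb{F}_q(t)[y_N]$ be the field generated over $\mathbb{F}_q(t)$ by a root $y_N$ of $N$, with the unique derivation extending $\frac{\mathrm{d}}{\mathrm{d}t}$, and write $x\in K_N$ for the image of $t$. Let $f_N\in K_N$ be such that $\partial-f_N$ is a right divisor of $\partial^p-y_N$ in $K_N\langle\partial\rangle$. For a nonzero $L\in\mathbb{F}_q(t)\langle\partial\rangle$, let $\psi_p^L$ be its $p$-curvature, that is, the $\mathbb{F}_q(t)$-linear endomorphism $v\mapsto\partial^p v$ of $\mathcal{D}_L=\mathbb{F}_q(t)\langle\partial\rangle/\mathbb{F}_q(t)\langle\partial\rangle L$, and let $\chi(\psi_p^L)$ be its characteristic polynomial. We write $L=\mathrm{LCLM}_i(L_i)$ when $\mathbb{F}_q(t)\langle\partial\rangle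 L=\bigcap_i\mathbb{F}_q(t)\langle\partial\rangle L_i$. An operator $L$ is decomposable if $L=\mathrm{LCLM}(A,B)$ for some $A,B\in\mathbb{F}_q(t)\langle\partial\rangle\setminus\mathbb{F}_q(t)$ that are coprime, that is, that generate the left ideal $\mathbb{F}_q(t)\langle\partial\rangle$; it is indecomposable otherwise. An $\mathrm{LCLM}$-decomposition of a nonzero $L$ is a family $(L_i)_i$ of indecomposable operators with $L=\mathrm{LCLM}_i(L_i)$ and $\operatorname{ord}L=\sum_i\operatorname{ord}L_i$. Let $m_1,\dots,m_p\ge 0$ be integers. For each $i\in\{1,\dots,p\}$ let $L_i\in\mathbb{F}_q(t)\langle\partial\rangle$ be a nonzero operator of order $m_i\deg N$ that is, in $K_N\langle\partial\rangle$, a left multiple of $(x\partial-xf_N+i)^{m_i}$. Let $L=\mathrm{LCLM}_{i=1}^p L_i$. Then: 1. each $L_i$ is indecomposable; 2. $\chi(\psi_p^{L_i})=N^{m_i}$ for each $i$; 3. $L\neq 0$ and $\operatorname{ord}L=\sum_{i=1}^p\operatorname{ord}L_i$. In particular, $(L_1,\dots,L_p)$ is an $\mathrm{LCLM}$-decomposition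 of $L$. -/

import Mathlib

open Polynomial
open scoped Differential

noncomputable section

/-! ### Two constructions of derivations -/

/-- An additive map that satisfies the Leibniz rule is a derivation. -/
@[reducible]
def Differential.ofLeibniz {R : Type*} [CommRing R] (d : R → R)
    (hadd : ∀ a b, d (a + b) = d a + d b) (hmul : ∀ a b, d (a * b) = a * d b + b * d a) :
    Differential R where
  deriv := Derivation.mk' (AddMonoidHom.mk' d hadd).toIntLinearMap hmul

/-- If the coefficients of `q` are constants, then differentiation of coefficients is a derivation
of `R[Y] / (q)`. -/
@[reducible]
def Differential.adjoinRoot {R : Type*} [CommRing R] [Differential R] (q : R[X])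
    (hq : Differential.mapCoeffs q = 0) : Differential (AdjoinRoot q) where
  deriv := Derivation.liftOfSurjective (f := (AdjoinRoot.mk q).toIntAlgHom)
    AdjoinRoot.mk_surjective (d := Differential.mapCoeffs) (by
      intro r hr
      have hr' : AdjoinRoot.mk q r = 0 := hr
      obtain ⟨r, rfl⟩ := AdjoinRoot.mk_eq_zero.mp hr'
      rw [Derivation.leibniz, hq, smul_zero, add_zero, smul_eq_mul]
      exact AdjoinRoot.mk_eq_zero.mpr (dvd_mul_right _ _))

theorem Differential.adjoinRoot_mk {R : Type*} [CommRing R] [Differential R] (q : R[X])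
    (hq : Differential.mapCoeffs q = 0) (r : R[X]) :
    letI := Differential.adjoinRoot q hq
    (AdjoinRoot.mk q r)′ = AdjoinRoot.mk q (Differential.mapCoeffs r) :=
  Derivation.liftOfSurjective_apply (f := (AdjoinRoot.mk q).toIntAlgHom)
    AdjoinRoot.mk_surjective _ r

theorem Differential.deriv_inv_eq_zero {R : Type*} [Field R] [Differential R] {a : R}
    (h : a′ = 0) : (a⁻¹)′ = 0 := by
  rw [Derivation.leibniz_inv, h, smul_zero]

theorem Differential.deriv_mul_eq_zero {R : Type*} [CommRing R] [Differential R] {a b : R}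
    (ha : a′ = 0) (hb : b′ = 0) : (a * b)′ = 0 := by
  rw [Derivation.leibniz, ha, hb, smul_zero, smul_zero, add_zero]

/-! ### The differential field `F(t)` -/

namespace RatDeriv

variable {F : Type*} [Field F]

/-- The derivative `d/dt` on `F(t)`, by the quotient rule. -/
def der (f : RatFunc F) : RatFunc F :=
  (algebraMap F[X] (RatFunc F) (derivative f.num) * algebraMap F[X] (RatFunc F) f.denom
      - algebraMap F[X] (RatFunc F) f.num * algebraMap F[X] (RatFunc F) (derivative f.denom))
    / algebraMap F[X] (RatFunc F) f.denom ^ 2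

theorem der_div (a b : F[X]) (hb : b ≠ 0) :
    der (algebraMap F[X] (RatFunc F) a / algebraMap F[X] (RatFunc F) b) =
      (algebraMap F[X] (RatFunc F) (derivative a) * algebraMap F[X] (RatFunc F) b
        - algebraMap F[X] (RatFunc F) a * algebraMap F[X] (RatFunc F) (derivative b))
      / algebraMap F[X] (RatFunc F) b ^ 2 := by
  set f := algebraMap F[X] (RatFunc F) a / algebraMap F[X] (RatFunc F) b with hf
  have hd : f.denom ≠ 0 := f.denom_ne_zero
  have hb' : algebraMap F[X] (RatFunc F) b ≠ 0 := RatFunc.algebraMap_ne_zero hb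
  have hd' : algebraMap F[X] (RatFunc F) f.denom ≠ 0 := RatFunc.algebraMap_ne_zero hd
  have h1 : algebraMap F[X] (RatFunc F) (a * f.denom)
      = algebraMap F[X] (RatFunc F) (f.num * b) := by
    have := f.num_div_denom
    rw [hf, ← hf, div_eq_div_iff hd' hb'] at this
    rw [map_mul, map_mul, this]
  have h2 : a * f.denom = f.num * b := RatFunc.algebraMap_injective F h1
  have h3 := congrArg (fun q => algebraMap F[X] (RatFunc F) (derivative q)) h2
  simp only [derivative_mul, map_add, map_mul] at h3 h1
  unfold der
  rw [div_eq_div_iff (pow_ne_zero 2 hd') (pow_ne_zero 2 hb')]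
  linear_combination
    (-(algebraMap F[X] (RatFunc F) b) * algebraMap F[X] (RatFunc F) f.denom) * h3
    + (algebraMap F[X] (RatFunc F) b * algebraMap F[X] (RatFunc F) (derivative f.denom)
      + algebraMap F[X] (RatFunc F) f.denom * algebraMap F[X] (RatFunc F) (derivative b)) * h1

theorem exists_div (f : RatFunc F) : ∃ a b : F[X], b ≠ 0 ∧
    f = algebraMap F[X] (RatFunc F) a / algebraMap F[X] (RatFunc F) b :=
  ⟨f.num, f.denom, f.denom_ne_zero, f.num_div_denom.symm⟩

theorem der_add (f g : RatFunc F) : der (f + g) = der f + der g := by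
  obtain ⟨a, b, hb, rfl⟩ := exists_div f
  obtain ⟨c, d, hd, rfl⟩ := exists_div g
  have hb' : algebraMap F[X] (RatFunc F) b ≠ 0 := RatFunc.algebraMap_ne_zero hb
  have hd' : algebraMap F[X] (RatFunc F) d ≠ 0 := RatFunc.algebraMap_ne_zero hd
  rw [div_add_div _ _ hb' hd', ← map_mul, ← map_mul, ← map_mul, ← map_add,
    der_div _ _ (mul_ne_zero hb hd), der_div _ _ hb, der_div _ _ hd]
  simp only [derivative_mul, map_add, map_mul]
  field_simp
  ring

theorem der_mul (f g : RatFunc F) : der (f * g) = f * der g + g * der f := by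
  obtain ⟨a, b, hb, rfl⟩ := exists_div f
  obtain ⟨c, d, hd, rfl⟩ := exists_div g
  have hb' : algebraMap F[X] (RatFunc F) b ≠ 0 := RatFunc.algebraMap_ne_zero hb
  have hd' : algebraMap F[X] (RatFunc F) d ≠ 0 := RatFunc.algebraMap_ne_zero hd
  rw [div_mul_div_comm, ← map_mul, ← map_mul,
    der_div _ _ (mul_ne_zero hb hd), der_div _ _ hb, der_div _ _ hd]
  simp only [derivative_mul, map_add, map_mul]
  field_simp
  ring

end RatDeriv

/-- `F(t)` with the derivation `d/dt`. -/
instance RatFunc.instDifferential {F : Type*} [Field F] : Differential (RatFunc F) :=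
  Differential.ofLeibniz RatDeriv.der RatDeriv.der_add RatDeriv.der_mul

theorem RatFunc.deriv_algebraMap_poly {F : Type*} [Field F] (a : F[X]) :
    (algebraMap F[X] (RatFunc F) a)′ = algebraMap F[X] (RatFunc F) (derivative a) := by
  have := RatDeriv.der_div a 1 one_ne_zero
  simp only [map_one, div_one, derivative_one, map_zero, mul_zero, sub_zero, mul_one,
    one_pow] at this
  exact this

/-- The subfield `F(t^p)` of `F(t)`. -/
def constField (F : Type*) [Field F] (p : ℕ) : IntermediateField F (RatFunc F) :=
  IntermediateField.adjoin F {(RatFunc.X : RatFunc F) ^ p}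

theorem constField.deriv_eq_zero {F : Type*} [Field F] {p : ℕ} [CharP F p]
    (c : constField F p) : ((c : RatFunc F))′ = 0 := by
  obtain ⟨c, hc⟩ := c
  refine IntermediateField.adjoin_induction F (p := fun c _ => c′ = 0) ?_ ?_ ?_ ?_ ?_ hc
  · intro x hx
    obtain rfl : x = RatFunc.X ^ p := hx
    rw [← RatFunc.algebraMap_X, ← map_pow, RatFunc.deriv_algebraMap_poly, derivative_X_pow]
    simp
  · intro a
    have h : algebraMap F (RatFunc F) a = algebraMap F[X] (RatFunc F) (C a) := by
      rw [RatFunc.algebraMap_C, RatFunc.algebraMap_eq_C]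
    rw [h, RatFunc.deriv_algebraMap_poly, derivative_C, map_zero]
  · intro x y _ _ hx hy
    rw [map_add, hx, hy, add_zero]
  · intro x _ hx
    exact Differential.deriv_inv_eq_zero hx
  · intro x y _ _ hx hy
    exact Differential.deriv_mul_eq_zero hx hy

/-! ### The extension `K_N = F(t)[y_N]` -/

/-- `K_N = F(t)[Y] / (N)`, generated over `F(t)` by a root `y_N` of `N ∈ F(t^p)[Y]`. It is a field
when `N` is irreducible and separable over `F(t^p)`. -/
def KN {F : Type*} [Field F] {p : ℕ} (N : (constField F p)[X]) : Type _ :=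
  AdjoinRoot (N.map (algebraMap (constField F p) (RatFunc F)))

namespace KN

variable {F : Type*} [Field F] {p : ℕ} (N : (constField F p)[X])

instance : CommRing (KN N) :=
  inferInstanceAs (CommRing (AdjoinRoot (N.map (algebraMap (constField F p) (RatFunc F)))))

instance : Algebra (RatFunc F) (KN N) :=
  inferInstanceAs (Algebra (RatFunc F)
    (AdjoinRoot (N.map (algebraMap (constField F p) (RatFunc F)))))

/-- The class of a polynomial in `F(t)[Y]`. -/
def mk : (RatFunc F)[X] →+* KN N :=
  AdjoinRoot.mk (N.map (algebraMap (constField F p) (RatFunc F)))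

/-- The element `y_N`, the class of `Y`. -/
def y : KN N := mk N X

/-- The element `x` of `K_N`, the image of the variable `t` of `F(t)`. -/
def x : KN N := algebraMap (RatFunc F) (KN N) RatFunc.X

theorem mapCoeffs_map [CharP F p] :
    Differential.mapCoeffs (N.map (algebraMap (constField F p) (RatFunc F))) = 0 := by
  ext i
  rw [Differential.coeff_mapCoeffs, coeff_map, coeff_zero]
  exact constField.deriv_eq_zero (N.coeff i)

/-- The derivation of `K_N` extending `d/dt`: it differentiates the coefficients of a polynomial in
`y_N` (the coefficients of `N` are constants, hence so is `y_N`). For `N` separable this is the only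
derivation of `K_N` that extends `d/dt`. -/
instance [CharP F p] : Differential (KN N) :=
  Differential.adjoinRoot _ (mapCoeffs_map N)

theorem deriv_mk [CharP F p] (q : (RatFunc F)[X]) :
    (mk N q)′ = mk N (Differential.mapCoeffs q) :=
  Differential.adjoinRoot_mk _ (mapCoeffs_map N) q

instance [CharP F p] : DifferentialAlgebra (RatFunc F) (KN N) where
  deriv_algebraMap a := by
    have h := deriv_mk N (C a)
    rw [Differential.mapCoeffs_C] at h
    exact h

end KN

/-! ### The ring of linear differential operators -/

/-- `R⟨∂⟩`: the linear differential operators `∑ fᵢ ∂ⁱ` with coefficients in the differential ring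
`R`. The additive group is that of polynomials in `∂` with coefficients written on the left;
the multiplication below is the one determined by `∂ f = f ∂ + f′`. -/
def DiffOp (R : Type*) [CommRing R] : Type _ := R[X]

namespace DiffOp

section Basic

variable {R : Type*} [CommRing R]

instance : AddCommGroup (DiffOp R) := inferInstanceAs (AddCommGroup R[X])

instance : Module R (DiffOp R) := inferInstanceAs (Module R R[X])

/-- The operator `∑ fᵢ ∂ⁱ` as the commutative polynomial `∑ fᵢ Xⁱ`. -/
def toPoly : DiffOp R ≃ₗ[R] R[X] := LinearEquiv.refl R R[X]

/-- The order of a (nonzero) operator. -/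
def ord (L : DiffOp R) : ℕ := (toPoly L).natDegree

/-- The operator `∂`. -/
def D : DiffOp R := toPoly.symm X

/-- Extension of coefficients, `R⟨∂⟩ → S⟨∂⟩`. -/
def baseChange (S : Type*) [CommRing S] [Algebra R S] (L : DiffOp R) : DiffOp S :=
  toPoly.symm ((toPoly L).map (algebraMap R S))

variable [Differential R]

/-- Left multiplication by `∂`: `∑ fᵢ ∂ⁱ ↦ ∑ fᵢ′ ∂ⁱ + ∑ fᵢ ∂ⁱ⁺¹`. -/
def dMul : R[X] →+ R[X] :=
  (Differential.mapCoeffs (A := R)).toLinearMap.toAddMonoidHom + AddMonoidHom.mulLeft X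

theorem dMul_apply (M : R[X]) : dMul M = Differential.mapCoeffs M + X * M := rfl

theorem dMul_C_mul (a : R) (M : R[X]) : dMul (C a * M) = C a′ * M + C a * dMul M := by
  simp only [dMul_apply, Derivation.leibniz, Differential.mapCoeffs_C, smul_eq_mul]
  ring

/-- Left multiplication by `∑ fᵢ ∂ⁱ`. -/
def act (L : R[X]) (M : R[X]) : R[X] := L.sum fun i a => C a * dMul^[i] M

theorem iter_zero (i : ℕ) : (dMul (R := R))^[i] 0 = 0 := by
  induction i with
  | zero => rfl
  | succ n ih => rw [Function.iterate_succ_apply', ih, map_zero]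

theorem iter_add (i : ℕ) (M M' : R[X]) :
    (dMul (R := R))^[i] (M + M') = dMul^[i] M + dMul^[i] M' := by
  induction i with
  | zero => rfl
  | succ n ih => simp only [Function.iterate_succ_apply', ih, map_add]

theorem act_monomial (i : ℕ) (a : R) (M : R[X]) :
    act (monomial i a) M = C a * dMul^[i] M := by
  unfold act
  rw [sum_monomial_index]
  simp

theorem act_add_left (L L' M : R[X]) : act (L + L') M = act L M + act L' M := by
  unfold act
  rw [sum_add_index] <;> intros <;> simp [add_mul]

theorem act_add_right (L M M' : R[X]) : act L (M + M') = act L M + act L M' := by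
  unfold act
  simp only [iter_add, mul_add]
  exact sum_add _ _ _

theorem act_zero_left (M : R[X]) : act 0 M = 0 := by
  unfold act
  simp

theorem act_zero_right (L : R[X]) : act L 0 = 0 := by
  unfold act
  simp [Polynomial.sum]

theorem act_C_mul (a : R) (L M : R[X]) : act (C a * L) M = C a * act L M := by
  induction L using Polynomial.induction_on' with
  | add p q hp hq => rw [mul_add, act_add_left, act_add_left, hp, hq, mul_add]
  | monomial n b => rw [C_mul_monomial, act_monomial, act_monomial, C_mul, mul_assoc]

theorem act_dMul (L M : R[X]) : act (dMul L) M = dMul (act L M) := by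
  induction L using Polynomial.induction_on' with
  | add p q hp hq => rw [map_add, act_add_left, act_add_left, hp, hq, map_add]
  | monomial n b =>
    rw [dMul_apply, Differential.mapCoeffs_monomial, X_mul_monomial, act_add_left, act_monomial,
      act_monomial, act_monomial, dMul_C_mul, Function.iterate_succ_apply']

theorem act_iter (i : ℕ) (L M : R[X]) : act (dMul^[i] L) M = dMul^[i] (act L M) := by
  induction i with
  | zero => rfl
  | succ n ih => rw [Function.iterate_succ_apply', act_dMul, ih, Function.iterate_succ_apply']

theorem act_act (L M P : R[X]) : act (act L M) P = act L (act M P) := by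
  induction L using Polynomial.induction_on' with
  | add p q hp hq => rw [act_add_left, act_add_left, act_add_left, hp, hq]
  | monomial n b => rw [act_monomial, act_monomial, act_C_mul, act_iter]

theorem act_one_left (M : R[X]) : act 1 M = M := by
  rw [← monomial_zero_one, act_monomial]
  simp

theorem iter_one (i : ℕ) : (dMul (R := R))^[i] 1 = X ^ i := by
  induction i with
  | zero => simp
  | succ n ih =>
    rw [Function.iterate_succ_apply', ih, dMul_apply, ← monomial_one_right_eq_X_pow,
      Differential.mapCoeffs_monomial, Derivation.map_one_eq_zero, map_zero, zero_add,
      X_mul_monomial, monomial_one_right_eq_X_pow]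

theorem act_one_right (L : R[X]) : act L 1 = L := by
  unfold act
  simp only [iter_one]
  exact sum_C_mul_X_pow_eq L

instance : Ring (DiffOp R) where
  __ := (inferInstance : AddCommGroup (DiffOp R))
  mul L M := toPoly.symm (act (toPoly L) (toPoly M))
  one := toPoly.symm 1
  left_distrib L M M' := act_add_right (R := R) L M M'
  right_distrib L L' M := act_add_left (R := R) L L' M
  zero_mul M := act_zero_left (R := R) M
  mul_zero L := act_zero_right (R := R) L
  mul_assoc L M P := act_act (R := R) L M P
  one_mul M := act_one_left (R := R) M
  mul_one L := act_one_right (R := R) L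

theorem toPoly_mul (L M : DiffOp R) : toPoly (L * M) = act (toPoly L) (toPoly M) := rfl

theorem toPoly_one : toPoly (1 : DiffOp R) = 1 := rfl

theorem toPoly_smul (a : R) (L : DiffOp R) : toPoly (a • L) = C a * toPoly L := by
  rw [map_smul, smul_eq_C_mul]

instance : IsScalarTower R (DiffOp R) (DiffOp R) where
  smul_assoc a L M := by
    apply toPoly.injective
    rw [smul_eq_mul, smul_eq_mul, toPoly_mul, toPoly_smul, toPoly_smul, act_C_mul, toPoly_mul]

/-- The elements of `R` as operators of order `0`. -/
def coef : R →+* DiffOp R where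
  toFun a := a • 1
  map_one' := one_smul _ _
  map_zero' := zero_smul _ _
  map_add' a b := add_smul _ _ _
  map_mul' a b := by rw [smul_mul_assoc, one_mul, mul_smul]

theorem coef_mul (a : R) (L : DiffOp R) : coef a * L = a • L := by
  change (a • 1) * L = _
  rw [smul_mul_assoc, one_mul]

theorem toPoly_D_mul (L : DiffOp R) : toPoly (D * L) = dMul (toPoly L) := by
  rw [toPoly_mul]
  change act X _ = _
  rw [← monomial_one_one_eq_X, act_monomial]
  simp

/-- The commutation rule `∂ f = f ∂ + f′`. -/
theorem D_mul_coef (a : R) : (D : DiffOp R) * coef a = coef a * D + coef a′ := by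
  apply toPoly.injective
  rw [toPoly_D_mul, coef_mul, map_add, toPoly_smul]
  change dMul (toPoly (a • 1)) = C a * X + toPoly (a′ • 1)
  rw [toPoly_smul, toPoly_smul, toPoly_one, dMul_C_mul, dMul_apply, Derivation.map_one_eq_zero]
  ring

/-- The coefficient form of an operator: `toPoly.symm (∑ fᵢ Xⁱ) = ∑ fᵢ ∂ⁱ`. -/
theorem toPoly_symm_monomial (n : ℕ) (a : R) :
    (toPoly.symm (monomial n a) : DiffOp R) = coef a * D ^ n := by
  apply toPoly.injective
  rw [LinearEquiv.apply_symm_apply, coef_mul, toPoly_smul]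
  have h : ∀ n : ℕ, toPoly ((D : DiffOp R) ^ n) = X ^ n := by
    intro n
    induction n with
    | zero => rw [pow_zero, pow_zero, toPoly_one]
    | succ n ih =>
      rw [pow_succ', toPoly_D_mul, ih, ← iter_one, ← iter_one, Function.iterate_succ_apply']
  rw [h, C_mul_X_pow_eq_monomial]

/-- The left ideal `R⟨∂⟩ L`. -/
def leftIdeal (L : DiffOp R) : Submodule (DiffOp R) (DiffOp R) :=
  Submodule.span (DiffOp R) {L}

/-- The left module `𝒟_L = R⟨∂⟩ / R⟨∂⟩ L`. -/
abbrev Quot (L : DiffOp R) : Type _ := DiffOp R ⧸ leftIdeal L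

/-- `L` is a left multiple of `M`. -/
def IsLeftMultiple (L M : DiffOp R) : Prop := ∃ Q : DiffOp R, L = Q * M

/-- `L = LCLM((L_i)_i)`: `R⟨∂⟩ L = ⋂ R⟨∂⟩ L_i`. -/
def IsLCLM {ι : Type*} (L : DiffOp R) (Ls : ι → DiffOp R) : Prop :=
  leftIdeal L = ⨅ i, leftIdeal (Ls i)

/-- `G = GCRD(L₁, L₂)`: `R⟨∂⟩ G = R⟨∂⟩ L₁ + R⟨∂⟩ L₂`. -/
def IsGCRD (G L₁ L₂ : DiffOp R) : Prop :=
  leftIdeal G = leftIdeal L₁ ⊔ leftIdeal L₂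

/-- `L` is decomposable: it is the LCLM of two coprime operators that do not lie in `R`. -/
def IsDecomposable (L : DiffOp R) : Prop :=
  ∃ L₁ L₂ : DiffOp R, L₁ ∉ Set.range (coef (R := R)) ∧ L₂ ∉ Set.range (coef (R := R)) ∧
    IsGCRD 1 L₁ L₂ ∧ IsLCLM L ![L₁, L₂]

/-- `L` is indecomposable. -/
def IsIndecomposable (L : DiffOp R) : Prop := ¬ IsDecomposable L

/-- `(L_i)_i` is an LCLM-decomposition of the (nonzero) operator `L`. -/
structure IsLCLMDecomposition {ι : Type*} [Fintype ι] (L : DiffOp R) (Ls : ι → DiffOp R) :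
    Prop where
  ne_zero : L ≠ 0
  indecomposable : ∀ i, IsIndecomposable (Ls i)
  isLCLM : IsLCLM L Ls
  ord_eq : ord L = ∑ i, ord (Ls i)

end Basic

/-! ### The `p`-curvature -/

section Finite

variable {K : Type*} [Field K] [Differential K]

/-- `𝒟_L` is finite-dimensional for `L ≠ 0`. -/
theorem finite_quot (L : DiffOp K) (hL : L ≠ 0) : Module.Finite K (Quot L) := by
  classical
  set π : DiffOp K →ₗ[K] Quot L := (leftIdeal L).mkQ.restrictScalars K with hπ
  set S : Submodule K (Quot L) :=
    Submodule.span K (Set.range fun i : Fin (ord L) => π (D ^ (i : ℕ))) with hS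
  have hmem : ∀ i, i < ord L → π (D ^ i) ∈ S := fun i hi =>
    Submodule.subset_span ⟨⟨i, hi⟩, rfl⟩
  have hsum : ∀ M : DiffOp K, M = (toPoly M).sum fun i a => a • D ^ i := by
    intro M
    conv_lhs => rw [← toPoly.symm_apply_apply M, ← sum_monomial_eq (toPoly M)]
    simp only [Polynomial.sum, map_sum, toPoly_symm_monomial, coef_mul]
  have hπL : π L = 0 := by
    rw [hπ]
    exact (Submodule.Quotient.mk_eq_zero _).mpr (Submodule.mem_span_singleton_self L)
  have hp : toPoly L ≠ 0 := fun h => hL (toPoly.injective (h.trans (map_zero _).symm))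
  have htop : π (D ^ ord L) ∈ S := by
    have h1 := hπL
    rw [congrArg π (hsum L), sum_over_range _ (fun i => zero_smul K (D ^ i)),
      Finset.sum_range_succ, map_add, map_smul] at h1
    have h2 : π (D ^ ord L) = -((toPoly L).leadingCoeff)⁻¹ •
        π (∑ i ∈ Finset.range (ord L), (toPoly L).coeff i • D ^ i) := by
      have h3 : π (∑ i ∈ Finset.range (ord L), (toPoly L).coeff i • D ^ i) =
          -((toPoly L).leadingCoeff • π (D ^ ord L)) := eq_neg_of_add_eq_zero_left h1
      rw [neg_smul, h3, smul_neg, neg_neg]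
      exact (inv_smul_smul₀ (leadingCoeff_ne_zero.mpr hp) _).symm
    rw [h2, map_sum]
    refine S.smul_mem _ (S.sum_mem fun i hi => ?_)
    rw [map_smul]
    exact S.smul_mem _ (hmem i (Finset.mem_range.mp hi))
  have hD : ∀ v ∈ S, (D : DiffOp K) • v ∈ S := by
    intro v hv
    induction hv using Submodule.span_induction with
    | mem v hv =>
      obtain ⟨i, rfl⟩ := hv
      have h : (D : DiffOp K) • π (D ^ (i : ℕ)) = π (D ^ ((i : ℕ) + 1)) := by
        rw [pow_succ']
        exact ((leftIdeal L).mkQ.map_smul _ _).symm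
      change (D : DiffOp K) • π (D ^ (i : ℕ)) ∈ S
      rw [h]
      rcases Nat.lt_or_ge ((i : ℕ) + 1) (ord L) with h' | h'
      · exact hmem _ h'
      · rw [show (i : ℕ) + 1 = ord L by have := i.2; omega]
        exact htop
    | zero => rw [smul_zero]; exact S.zero_mem
    | add u v _ _ hu hv => rw [smul_add]; exact S.add_mem hu hv
    | smul a v hv' hv =>
      have h : (D : DiffOp K) • a • v = a • (D : DiffOp K) • v + a′ • v := by
        have e : ∀ (b : K) (w : Quot L), b • w = coef b • w := by
          intro b w
          change b • w = (b • (1 : DiffOp K)) • w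
          rw [smul_assoc, one_smul]
        rw [e, smul_smul, D_mul_coef, add_smul, mul_smul, ← e, ← e]
      rw [h]
      exact S.add_mem (S.smul_mem _ hv) (S.smul_mem _ hv')
  have hpow : ∀ n : ℕ, π (D ^ n) ∈ S := by
    intro n
    induction n with
    | zero =>
      rcases Nat.eq_zero_or_pos (ord L) with h | h
      · rw [h] at htop; exact htop
      · exact hmem 0 h
    | succ n ih =>
      have h : π (D ^ (n + 1)) = (D : DiffOp K) • π (D ^ n) := by
        rw [pow_succ']
        exact (leftIdeal L).mkQ.map_smul _ _
      rw [h]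
      exact hD _ ih
  have hS_top : S = ⊤ := by
    rw [eq_top_iff]
    rintro v -
    obtain ⟨M, rfl⟩ := (leftIdeal L).mkQ_surjective v
    change π M ∈ S
    rw [hsum M]
    simp only [Polynomial.sum, map_sum, map_smul]
    exact S.sum_mem fun i _ => S.smul_mem _ (hpow i)
  exact ⟨hS_top ▸ Submodule.fg_span (Set.finite_range _)⟩

end Finite

section PCurvature

variable {F : Type*} [Field F] (p : ℕ) [CharP F p]

theorem D_pow_mul_X (n : ℕ) : (D : DiffOp (RatFunc F)) ^ n * coef RatFunc.X =
    coef RatFunc.X * D ^ n + n • D ^ (n - 1) := by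
  have h1 : (RatFunc.X : RatFunc F)′ = 1 := by
    rw [← RatFunc.algebraMap_X, RatFunc.deriv_algebraMap_poly, derivative_X, map_one]
  induction n with
  | zero => simp
  | succ n ih =>
    rw [pow_succ', mul_assoc, ih, mul_add, ← mul_assoc, D_mul_coef, h1, map_one, add_mul, one_mul,
      mul_assoc, mul_smul_comm, add_assoc, Nat.add_sub_cancel, add_smul, one_smul, add_comm (D ^ n)]
    cases n with
    | zero => simp
    | succ k => rw [Nat.add_sub_cancel, ← pow_succ' D k]

/-- `∂^p` commutes with the elements of `F(t)`. -/
theorem D_pow_char_comm (f : RatFunc F) :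
    (D : DiffOp (RatFunc F)) ^ p * coef f = coef f * D ^ p := by
  have hpoly : ∀ a : F[X], Commute ((D : DiffOp (RatFunc F)) ^ p)
      (coef (algebraMap F[X] (RatFunc F) a)) := by
    intro a
    induction a using Polynomial.induction_on' with
    | add a b ha hb => rw [map_add, map_add]; exact ha.add_right hb
    | monomial n c =>
      rw [← C_mul_X_pow_eq_monomial, map_mul, map_mul, map_pow, map_pow]
      refine Commute.mul_right ?_ (Commute.pow_right ?_ n)
      · refine Commute.pow_left ?_ p
        change D * _ = _
        rw [D_mul_coef, RatFunc.deriv_algebraMap_poly, derivative_C, map_zero, map_zero, add_zero]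
      · change _ * _ = _
        have hp0 : (p : DiffOp (RatFunc F)) = 0 := by
          rw [← map_natCast (coef (R := RatFunc F)) p,
            ← map_natCast (algebraMap F (RatFunc F)) p, CharP.cast_eq_zero, map_zero, map_zero]
        rw [RatFunc.algebraMap_X, D_pow_mul_X, nsmul_eq_mul, hp0, zero_mul, add_zero]
  obtain ⟨a, b, hb, rfl⟩ := RatDeriv.exists_div f
  have hu : coef (algebraMap F[X] (RatFunc F) b) *
      coef (algebraMap F[X] (RatFunc F) b)⁻¹ = 1 := by
    rw [← map_mul, mul_inv_cancel₀ (RatFunc.algebraMap_ne_zero hb), map_one]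
  have hu' : coef (algebraMap F[X] (RatFunc F) b)⁻¹ *
      coef (algebraMap F[X] (RatFunc F) b) = 1 := by
    rw [← map_mul, inv_mul_cancel₀ (RatFunc.algebraMap_ne_zero hb), map_one]
  rw [div_eq_mul_inv, map_mul]
  refine Commute.mul_right (hpoly a) ?_
  exact Commute.units_inv_right (u := ⟨_, _, hu, hu'⟩) (hpoly b)

/-- The `p`-curvature `ψ_p^L` of `L ∈ F(t)⟨∂⟩`: the `F(t)`-linear endomorphism of `𝒟_L` given by
multiplication by `∂^p`. -/
def pCurvature (L : DiffOp (RatFunc F)) : Module.End (RatFunc F) (Quot L) where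
  toFun v := (D : DiffOp (RatFunc F)) ^ p • v
  map_add' u v := smul_add _ u v
  map_smul' a v := by
    have e : ∀ (b : RatFunc F) (w : Quot L), b • w = coef b • w := by
      intro b w
      change b • w = (b • (1 : DiffOp (RatFunc F))) • w
      rw [smul_assoc, one_smul]
    rw [RingHom.id_apply, e, e, smul_smul, smul_smul, D_pow_char_comm]

/-- The characteristic polynomial `χ(ψ_p^L)` of the `p`-curvature of a nonzero operator `L`. -/
def pCurvatureCharpoly (L : DiffOp (RatFunc F)) (hL : L ≠ 0) : (RatFunc F)[X] :=
  haveI := finite_quot L hL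
  (pCurvature p L).charpoly

end PCurvature

end DiffOp

end

noncomputable section

/-! ### Divisibility and lifting of polynomials at a simple root. -/

section PowerLemmas

variable {k K : Type*} [Field k] [Field K] [Algebra k K]

/-! Write k = F(t), K = K_N, y = y_N, f = f_N and δ = x(∂ - f). Everything rests on one identity in
K⟨∂⟩. Since [∂ - f, x] = 1, the falling factorial δ(δ - 1)⋯(δ - p + 1) equals x^p (∂ - f)^p. In
characteristic p the left side is ∏ (δ + i) over i = 1, …, p, and (∂ - f)^p = ∂^p - y
(`D_sub_coef_pow_char`). So the central operator ∂^p - y is, up to the unit x^p, a product of p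
commuting factors, pairwise coprime as polynomials in δ over the prime field
(`evalPrimeField_prod_eulerFactor_pow`).

It follows that the polynomials μ for which μ(∂^p) is a left multiple of (δ + i)^m are divisible by
(Y - y)^m (`X_sub_C_pow_dvd_of_evalDPow_mem`). Because y is a simple root of N, this descends to k:
if μ(∂^p) is a left multiple of L_i, then N^{m_i} divides μ (`pow_dvd_of_mem_annihilator`). By
Cayley–Hamilton χ(ψ_p) is such a μ, and its degree is ord L_i = m_i deg N, hence χ(ψ_p) = N^{m_i}.
So 𝒟_{L_i} is cyclic over k[∂^p] as far as minimal polynomials can tell: the minimal and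
characteristic polynomials of ψ_p agree and are a power of an irreducible. In a decomposition into
coprime A and B, one of them must carry the full power N^{m_i}, hence the full order, and the other
is then a unit (`isIndecomposable_of_annihilator`).

For the order of L, the bound ≤ is the injection of 𝒟_L into ∏ 𝒟_{L_i}. For ≥, L is over K a left
multiple of P = ∏ (δ + i)^{m_i}, of order ∑ m_i. Some power of ∂^p - y is a left multiple of P, and
modulo a power of Y - y each element of K is congruent to a polynomial over k (Hensel), so k⟨∂⟩ maps
onto K⟨∂⟩/K⟨∂⟩P. Comparing k-dimensions gives [K : k] ∑ m_i ≤ ord L (`finrank_mul_ord_le`,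
`sum_mul_finrank_le_ord`). -/

theorem Polynomial.Separable.exists_map_eq_mul {f : k[X]} (hf : f.Separable) {y : K}
    (hy : aeval y f = 0) :
    ∃ g : K[X], f.map (algebraMap k K) = (X - C y) * g ∧ g.eval y ≠ 0 := by
  have hroot : (f.map (algebraMap k K)).eval y = 0 := by rwa [eval_map_algebraMap]
  obtain ⟨g, hg⟩ := dvd_iff_isRoot.mpr hroot
  refine ⟨g, hg, fun h0 => ?_⟩
  have h1 := (hf.map (f := algebraMap k K)).eval₂_derivative_ne_zero (RingHom.id K) (x := y)
    (by simpa [eval₂_id] using hroot)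
  apply h1
  rw [hg, derivative_mul]
  simp [h0]

theorem Polynomial.isCoprime_X_sub_C_pow {g : K[X]} {y : K} (hg : g.eval y ≠ 0) (m : ℕ) :
    IsCoprime ((X - C y) ^ m) g := by
  refine IsCoprime.pow_left (((irreducible_X_sub_C y).coprime_iff_not_dvd).mpr ?_)
  rwa [dvd_iff_isRoot]

/-- The multiplicity of `f` in a polynomial over `k` can be read off at a simple root of `f`. -/
theorem Polynomial.pow_dvd_of_X_sub_C_pow_dvd {f : k[X]} (hf : f.Separable) {y : K}
    (hy : aeval y f = 0) (hmin : ∀ μ : k[X], aeval y μ = 0 → f ∣ μ) (m : ℕ) :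
    ∀ μ : k[X], (X - C y) ^ m ∣ μ.map (algebraMap k K) → f ^ m ∣ μ := by
  obtain ⟨g, hg, hgy⟩ := hf.exists_map_eq_mul hy
  induction m with
  | zero => intro μ _; simp
  | succ m ih =>
    intro μ hμ
    have h0 : aeval y μ = 0 := by
      have : X - C y ∣ μ.map (algebraMap k K) := (dvd_pow_self _ m.succ_ne_zero).trans hμ
      rw [← eval_map_algebraMap]
      exact dvd_iff_isRoot.mp this
    obtain ⟨ν, rfl⟩ := hmin μ h0
    rw [Polynomial.map_mul, hg, mul_assoc, pow_succ'] at hμ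
    have h1 := (mul_dvd_mul_iff_left (X_sub_C_ne_zero y)).mp hμ
    rw [pow_succ']
    exact mul_dvd_mul_left f (ih ν ((isCoprime_X_sub_C_pow hgy m).dvd_of_dvd_mul_left h1))

/-- Hensel lifting: modulo a power of `Y - y`, every polynomial over `K = k[y]` is congruent to a
polynomial over `k`. -/
theorem Polynomial.exists_X_sub_C_pow_dvd_sub_map {f : k[X]} (hf : f.Separable) {y : K}
    (hy : aeval y f = 0) (hgen : ∀ a : K, ∃ h : k[X], aeval y h = a) (m : ℕ) :
    ∀ R : K[X], ∃ H : k[X], (X - C y) ^ m ∣ R - H.map (algebraMap k K) := by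
  obtain ⟨g, hg, hgy⟩ := hf.exists_map_eq_mul hy
  induction m with
  | zero => intro R; exact ⟨0, by simp⟩
  | succ m ih =>
    intro R
    obtain ⟨h, hh⟩ := hgen (R.eval y)
    obtain ⟨S, hS⟩ : X - C y ∣ R - h.map (algebraMap k K) := by
      rw [dvd_iff_isRoot, IsRoot.def, eval_sub, eval_map_algebraMap, hh, sub_self]
    obtain ⟨u, a, hua⟩ := isCoprime_X_sub_C_pow hgy m
    obtain ⟨H, T, hT⟩ := ih (a * S)
    -- With R - h = (Y - y) S and f = (Y - y) g, the correction must satisfy g H ≡ S modulo (Y -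
    -- y)^m. Since a inverts g there, H is taken to be a lift of a S.
    refine ⟨h + f * H, u * S + g * T, ?_⟩
    rw [Polynomial.map_add, Polynomial.map_mul, hg]
    linear_combination hS + (X - C y) * g * hT - (X - C y) * S * hua

end PowerLemmas

/-! ### Pure inseparability of F(t) over F(t^p). -/

/-- Every p-th power in F(t) lies in F(t^p), by Frobenius. This is what keeps a separable
irreducible N irreducible over F(t), so that K_N is a field. -/
theorem constField.isPurelyInseparable {F : Type*} [Field F] (p : ℕ) [Fact p.Prime] [CharP F p] :
    IsPurelyInseparable (constField F p) (RatFunc F) := by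
  have : CharP (constField F p) p :=
    charP_of_injective_algebraMap (algebraMap F (constField F p)).injective p
  have : CharP (RatFunc F) p :=
    charP_of_injective_algebraMap (algebraMap F (RatFunc F)).injective p
  rw [isPurelyInseparable_iff_pow_mem (constField F p) p]
  have hpoly : ∀ a : F[X], (algebraMap F[X] (RatFunc F) a) ^ p ∈ constField F p := by
    intro a
    induction a using Polynomial.induction_on' with
    | add a b ha hb =>
      rw [map_add, add_pow_char]
      exact add_mem ha hb
    | monomial n c =>
      rw [← C_mul_X_pow_eq_monomial, map_mul, mul_pow, map_pow, RatFunc.algebraMap_X, ← pow_mul,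
        mul_comm n p, pow_mul, RatFunc.algebraMap_C, ← RatFunc.algebraMap_eq_C]
      exact mul_mem (pow_mem ((constField F p).algebraMap_mem c) p)
        (pow_mem (IntermediateField.mem_adjoin_simple_self F _) n)
  intro f
  obtain ⟨a, b, hb, rfl⟩ := RatDeriv.exists_div f
  refine ⟨1, ⟨_, ?_⟩, rfl⟩
  have h := div_pow (algebraMap F[X] (RatFunc F) a) (algebraMap F[X] (RatFunc F) b) p
  rw [pow_one]
  refine (congrArg (· ∈ constField F p) h).mpr ?_
  exact div_mem (hpoly a) (hpoly b)

namespace DiffOp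

/-! ### Orders of products and left ideals. -/

section Order

variable {R : Type*} [CommRing R]

theorem ord_D [Nontrivial R] : ord (D : DiffOp R) = 1 := natDegree_X (R := R)

variable [Differential R]

theorem toPoly_coef (a : R) : toPoly (coef a) = C a := by
  change toPoly (a • (1 : DiffOp R)) = C a
  rw [toPoly_smul, toPoly_one, mul_one]

theorem natDegree_dMul_le {M : R[X]} {n : ℕ} (hM : M.natDegree ≤ n) :
    (dMul M).natDegree ≤ n + 1 := by
  rw [natDegree_le_iff_coeff_eq_zero]
  intro j hj
  obtain ⟨j, rfl⟩ : ∃ i, j = i + 1 := ⟨j - 1, by omega⟩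
  rw [dMul_apply, coeff_add, coeff_X_mul, Differential.coeff_mapCoeffs,
    coeff_eq_zero_of_natDegree_lt (by omega), coeff_eq_zero_of_natDegree_lt (by omega), map_zero,
    add_zero]

theorem coeff_dMul {M : R[X]} {n : ℕ} (hM : M.natDegree ≤ n) :
    (dMul M).coeff (n + 1) = M.coeff n := by
  rw [dMul_apply, coeff_add, coeff_X_mul, Differential.coeff_mapCoeffs,
    coeff_eq_zero_of_natDegree_lt (by omega), map_zero, zero_add]

theorem natDegree_dMul_iterate_le {M : R[X]} {n : ℕ} (hM : M.natDegree ≤ n) (i : ℕ) :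
    (dMul^[i] M).natDegree ≤ i + n := by
  induction i with
  | zero => simpa using hM
  | succ i ih =>
    rw [Function.iterate_succ_apply', add_right_comm]
    exact natDegree_dMul_le ih

theorem coeff_dMul_iterate {M : R[X]} {n : ℕ} (hM : M.natDegree ≤ n) (i : ℕ) :
    (dMul^[i] M).coeff (i + n) = M.coeff n := by
  induction i with
  | zero => simp
  | succ i ih =>
    rw [Function.iterate_succ_apply', add_right_comm, coeff_dMul (natDegree_dMul_iterate_le hM i),
      ih]

theorem natDegree_act_le {L M : R[X]} {l n : ℕ} (hL : L.natDegree ≤ l) (hM : M.natDegree ≤ n) :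
    (act L M).natDegree ≤ l + n := by
  rw [act, sum_over_range' _ (by simp) (l + 1) (by omega)]
  refine natDegree_sum_le_of_forall_le _ _ fun i hi => ?_
  have hi' := Finset.mem_range.mp hi
  exact (natDegree_C_mul_le _ _).trans ((natDegree_dMul_iterate_le hM i).trans (by omega))

/-- Moving ∂ past a coefficient only creates terms of lower order, so top coefficients multiply as
for commutative polynomials. Stated with upper bounds l and n, it also covers vanishing top
coefficients. -/
theorem coeff_act {L M : R[X]} {l n : ℕ} (hL : L.natDegree ≤ l) (hM : M.natDegree ≤ n) :
    (act L M).coeff (l + n) = L.coeff l * M.coeff n := by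
  rw [act, sum_over_range' _ (by simp) (l + 1) (by omega), finsetSum_coeff,
    Finset.sum_range_succ, coeff_C_mul, coeff_dMul_iterate hM, Finset.sum_eq_zero, zero_add]
  intro i hi
  have hi' := Finset.mem_range.mp hi
  rw [coeff_C_mul, coeff_eq_zero_of_natDegree_lt (p := dMul^[i] M), mul_zero]
  exact (natDegree_dMul_iterate_le hM i).trans_lt (by omega)

theorem toPoly_ne_zero {L : DiffOp R} (hL : L ≠ 0) : toPoly L ≠ 0 :=
  (LinearEquiv.map_ne_zero_iff _).mpr hL

instance [Nontrivial R] : Nontrivial (DiffOp R) := inferInstanceAs (Nontrivial R[X])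

theorem coeff_ord_ne_zero {L : DiffOp R} (hL : L ≠ 0) : (toPoly L).coeff (ord L) ≠ 0 :=
  leadingCoeff_ne_zero.mpr (toPoly_ne_zero hL)

theorem coeff_mul_ord (L M : DiffOp R) :
    (toPoly (L * M)).coeff (ord L + ord M) =
      (toPoly L).coeff (ord L) * (toPoly M).coeff (ord M) := by
  rw [toPoly_mul]
  exact coeff_act le_rfl le_rfl

instance [IsDomain R] : NoZeroDivisors (DiffOp R) where
  eq_zero_or_eq_zero_of_mul_eq_zero {L M} h := by
    by_contra! hLM
    have h1 := coeff_mul_ord L M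
    rw [h, map_zero, coeff_zero] at h1
    exact mul_ne_zero (coeff_ord_ne_zero hLM.1) (coeff_ord_ne_zero hLM.2) h1.symm

theorem ord_mul [IsDomain R] {L M : DiffOp R} (hL : L ≠ 0) (hM : M ≠ 0) :
    ord (L * M) = ord L + ord M := by
  refine le_antisymm (natDegree_act_le le_rfl le_rfl) (le_natDegree_of_ne_zero ?_)
  rw [coeff_mul_ord]
  exact mul_ne_zero (coeff_ord_ne_zero hL) (coeff_ord_ne_zero hM)

theorem ord_one : ord (1 : DiffOp R) = 0 := natDegree_one (R := R)

theorem ord_pow [IsDomain R] {L : DiffOp R} (hL : L ≠ 0) (n : ℕ) :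
    ord (L ^ n) = n * ord L := by
  induction n with
  | zero => rw [pow_zero, ord_one, zero_mul]
  | succ n ih => rw [pow_succ, ord_mul (pow_ne_zero n hL) hL, ih, Nat.succ_mul]

theorem eq_coef_of_ord_eq_zero {L : DiffOp R} (hL : ord L = 0) :
    L = coef ((toPoly L).coeff 0) := by
  apply toPoly.injective
  rw [toPoly_coef]
  exact eq_C_of_natDegree_eq_zero hL

theorem ord_coef (a : R) : ord (coef a) = 0 := by
  rw [ord, toPoly_coef, natDegree_C]

theorem mem_leftIdeal {L M : DiffOp R} : M ∈ leftIdeal L ↔ IsLeftMultiple M L := by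
  rw [leftIdeal, Submodule.mem_span_singleton]
  exact exists_congr fun Q => eq_comm

theorem ord_le_of_mem_leftIdeal [IsDomain R] {L M : DiffOp R} (h : M ∈ leftIdeal L) (hM : M ≠ 0) :
    ord L ≤ ord M := by
  obtain ⟨Q, rfl⟩ := mem_leftIdeal.mp h
  rw [ord_mul (left_ne_zero_of_mul hM) (right_ne_zero_of_mul hM)]
  exact Nat.le_add_left _ _

theorem self_mem_leftIdeal (L : DiffOp R) : L ∈ leftIdeal L := Submodule.mem_span_singleton_self L

theorem leftIdeal_le_leftIdeal {L M : DiffOp R} : leftIdeal L ≤ leftIdeal M ↔ L ∈ leftIdeal M :=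
  Submodule.span_singleton_le_iff_mem _ _

theorem mul_mem_leftIdeal (Q : DiffOp R) {L M : DiffOp R} (h : M ∈ leftIdeal L) :
    Q * M ∈ leftIdeal L := (leftIdeal L).smul_mem Q h

end Order

/-! ### Right Euclidean division and the dimension of 𝒟_L. -/

section Division

variable {K : Type*} [Field K] [Differential K]

theorem coef_inv_mul_coef {a : K} (ha : a ≠ 0) : coef a⁻¹ * coef a = 1 := by
  rw [← map_mul, inv_mul_cancel₀ ha, map_one]

/-- The remainder is bounded through `degreeLT` because the zero operator has `ord` 0: when L has
order 0, this forces the remainder to vanish. -/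
theorem exists_mul_add {L : DiffOp K} (hL : L ≠ 0) (M : DiffOp K) :
    ∃ Q R : DiffOp K, M = Q * L + R ∧ toPoly R ∈ degreeLT K (ord L) := by
  suffices H : ∀ n, ∀ M : DiffOp K, toPoly M ∈ degreeLT K n →
      ∃ Q R : DiffOp K, M = Q * L + R ∧ toPoly R ∈ degreeLT K (ord L) from
    H _ M (mem_degreeLT.mpr (degree_lt_iff_coeff_zero _ _ |>.mpr fun j hj =>
      coeff_eq_zero_of_natDegree_lt (n := j) (p := toPoly M) (Nat.lt_of_succ_le hj)))
  intro n
  induction n with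
  | zero =>
    intro M hM
    refine ⟨0, M, by simp, degreeLT_mono (Nat.zero_le _) hM⟩
  | succ n ih =>
    intro M hM
    rcases Nat.lt_or_ge n (ord L) with hn | hn
    · exact ⟨0, M, by simp, degreeLT_mono hn hM⟩
    obtain ⟨l, rfl⟩ : ∃ l, n = l + ord L := ⟨n - ord L, by omega⟩
    rw [mem_degreeLT, degree_lt_iff_coeff_zero] at hM
    set c := (toPoly M).coeff (l + ord L) / (toPoly L).coeff (ord L) with hc
    set Q : DiffOp K := toPoly.symm (monomial l c) with hQ
    have hQl : (toPoly Q).natDegree ≤ l := by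
      rw [hQ, LinearEquiv.apply_symm_apply]
      exact natDegree_monomial_le _
    obtain ⟨Q', S, h, hS⟩ := ih (M - Q * L) (by
      rw [mem_degreeLT, degree_lt_iff_coeff_zero]
      intro j hj
      rw [map_sub, coeff_sub, toPoly_mul]
      rcases hj.eq_or_lt with rfl | hj
      · rw [coeff_act (n := ord L) hQl le_rfl, hQ, LinearEquiv.apply_symm_apply, coeff_monomial_same, hc,
          div_mul_cancel₀ _ (coeff_ord_ne_zero hL), sub_self]
      · rw [hM j hj, coeff_eq_zero_of_natDegree_lt
          ((natDegree_act_le hQl le_rfl).trans_lt hj), sub_zero])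
    exact ⟨Q + Q', S, by rw [add_mul, add_assoc, ← h, add_sub_cancel], hS⟩

/-- Right division by `L` identifies `𝒟_L` with the space of operators of order `< ord L`. -/
def degreeLTEquivQuot (L : DiffOp K) (hL : L ≠ 0) : degreeLT K (ord L) ≃ₗ[K] Quot L :=
  LinearEquiv.ofBijective
    (((leftIdeal L).mkQ.restrictScalars K) ∘ₗ toPoly.symm.toLinearMap ∘ₗ (degreeLT K _).subtype) <| by
    constructor
    · rw [← LinearMap.ker_eq_bot, LinearMap.ker_eq_bot']
      rintro ⟨R, hR⟩ h
      have h' : toPoly.symm R ∈ leftIdeal L := (Submodule.Quotient.mk_eq_zero _).mp h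
      by_contra h0
      have hR0 : R ≠ 0 := fun h1 => h0 (Subtype.ext h1)
      have h1 := ord_le_of_mem_leftIdeal h' ((LinearEquiv.map_ne_zero_iff _).mpr hR0)
      rw [mem_degreeLT] at hR
      exact h1.not_gt ((natDegree_lt_iff_degree_lt hR0).mpr hR)
    · intro v
      obtain ⟨M, rfl⟩ := (leftIdeal L).mkQ_surjective v
      obtain ⟨Q, R, h, hR⟩ := exists_mul_add hL M
      refine ⟨⟨toPoly R, hR⟩, ?_⟩
      refine ((Submodule.Quotient.eq (leftIdeal L)).mpr ?_ :
        (Submodule.Quotient.mk R : Quot L) = Submodule.Quotient.mk M)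
      rw [h, sub_add_cancel_right]
      exact neg_mem (mul_mem_leftIdeal Q (self_mem_leftIdeal L))

theorem finrank_quot (L : DiffOp K) (hL : L ≠ 0) : Module.finrank K (Quot L) = ord L := by
  rw [← (degreeLTEquivQuot L hL).finrank_eq, (degreeLTEquiv K (ord L)).finrank_eq,
    Module.finrank_fin_fun]

end Division

/-! ### Extension of coefficients as a ring homomorphism. -/

section BaseChange

variable {R : Type*} (S : Type*) [CommRing R] [CommRing S] [Algebra R S]

theorem toPoly_baseChange (L : DiffOp R) :
    toPoly (L.baseChange S) = (toPoly L).map (algebraMap R S) := rfl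

theorem baseChange_D : (D : DiffOp R).baseChange S = D := map_X (algebraMap R S)

variable [Differential R] [Differential S] [DifferentialAlgebra R S]

theorem map_dMul (M : R[X]) :
    (dMul M).map (algebraMap R S) = dMul (M.map (algebraMap R S)) := by
  ext i
  rw [dMul_apply, dMul_apply, Polynomial.map_add, Polynomial.map_mul, map_X, coeff_add, coeff_add,
    coeff_map, Differential.coeff_mapCoeffs, Differential.coeff_mapCoeffs, coeff_map,
    deriv_algebraMap]

theorem map_dMul_iterate (M : R[X]) (i : ℕ) :
    (dMul^[i] M).map (algebraMap R S) = dMul^[i] (M.map (algebraMap R S)) := by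
  induction i with
  | zero => rfl
  | succ i ih => rw [Function.iterate_succ_apply', map_dMul, ih, Function.iterate_succ_apply']

theorem map_act (L M : R[X]) :
    (act L M).map (algebraMap R S) = act (L.map (algebraMap R S)) (M.map (algebraMap R S)) := by
  induction L using Polynomial.induction_on' with
  | add p q hp hq =>
    rw [act_add_left, Polynomial.map_add, hp, hq, Polynomial.map_add, act_add_left]
  | monomial n b =>
    rw [act_monomial, map_monomial, act_monomial, Polynomial.map_mul, map_C, map_dMul_iterate]

/-- Extension of coefficients as a ring homomorphism. -/
def baseChangeHom : DiffOp R →+* DiffOp S where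
  toFun := baseChange S
  map_one' := Polynomial.map_one (algebraMap R S)
  map_mul' L M := map_act S (toPoly L) (toPoly M)
  map_zero' := Polynomial.map_zero (algebraMap R S)
  map_add' _ _ := Polynomial.map_add (algebraMap R S)

theorem baseChangeHom_apply (L : DiffOp R) : baseChangeHom S L = L.baseChange S := rfl

theorem baseChangeHom_D : baseChangeHom S (D : DiffOp R) = D := baseChange_D S

theorem baseChangeHom_coef (a : R) : baseChangeHom S (coef a) = coef (algebraMap R S a) := by
  apply toPoly.injective
  rw [baseChangeHom_apply, toPoly_baseChange, toPoly_coef, toPoly_coef, map_C]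

theorem baseChangeHom_mem_leftIdeal {L M : DiffOp R} {P : DiffOp S} (h : M ∈ leftIdeal L)
    (hL : baseChangeHom S L ∈ leftIdeal P) : baseChangeHom S M ∈ leftIdeal P := by
  obtain ⟨Q, rfl⟩ := mem_leftIdeal.mp h
  rw [map_mul]
  exact mul_mem_leftIdeal _ hL

end BaseChange

end DiffOp

/-! ### Consequences of the Weyl relation ab = ba + 1. -/

section Weyl

variable {A : Type*} [Ring A]

theorem pow_mul_of_mul_eq_mul_add_one {a b : A} (h : a * b = b * a + 1) (n : ℕ) :
    a ^ n * b = b * a ^ n + n * a ^ (n - 1) := by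
  induction n with
  | zero => simp
  | succ n ih =>
    rw [pow_succ', mul_assoc, ih, mul_add, ← mul_assoc, h, add_mul, one_mul, mul_assoc b,
      Nat.add_sub_cancel, ← mul_assoc a (n : A), ← Nat.cast_comm, mul_assoc (n : A), add_assoc,
      Nat.cast_succ, add_mul, one_mul, add_comm (a ^ n)]
    cases n with
    | zero => simp
    | succ k => rw [Nat.add_sub_cancel, ← pow_succ' a k]

theorem mul_pow_of_mul_eq_mul_add_one {a b : A} (h : a * b = b * a + 1) (n : ℕ) :
    a * b ^ n = b ^ n * a + n * b ^ (n - 1) := by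
  induction n with
  | zero => simp
  | succ n ih =>
    rw [pow_succ, ← mul_assoc, ih, add_mul, mul_assoc, h, mul_add, mul_one, ← mul_assoc,
      Nat.add_sub_cancel, mul_assoc (n : A), add_assoc, Nat.cast_succ, add_mul, one_mul,
      add_comm (b ^ n)]
    cases n with
    | zero => simp
    | succ k => rw [Nat.add_sub_cancel, ← pow_succ b k]

/-- Evaluation of polynomials over the prime field in a ring of characteristic `p`. -/
def evalPrimeField (p : ℕ) [CharP A p] (δ : A) : (ZMod p)[X] →+* A :=
  letI := ZMod.algebra A p
  (aeval δ).toRingHom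

variable (p : ℕ) [CharP A p]

theorem evalPrimeField_X (δ : A) : evalPrimeField p δ X = δ :=
  letI := ZMod.algebra A p
  aeval_X δ

/-- The relation (ba - n) bⁿ = bⁿ⁺¹ a turns each new factor of the falling factorial of ba into one
more b and one more a. -/
theorem evalPrimeField_descPochhammer {a b : A} (h : a * b = b * a + 1) (n : ℕ) :
    evalPrimeField p (b * a) (descPochhammer (ZMod p) n) = b ^ n * a ^ n := by
  induction n with
  | zero => simp
  | succ n ih =>
    have h1 : b * a * b ^ n = b ^ (n + 1) * a + n * b ^ n := by
      rw [mul_assoc, mul_pow_of_mul_eq_mul_add_one h, mul_add, ← mul_assoc, ← pow_succ',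
        ← mul_assoc, ← Nat.cast_comm, mul_assoc]
      cases n with
      | zero => simp
      | succ k => rw [Nat.add_sub_cancel, ← pow_succ' b k]
    rw [descPochhammer_succ_right, mul_comm, map_mul, ih, map_sub, evalPrimeField_X, map_natCast,
      sub_mul, ← mul_assoc, h1, add_mul, mul_assoc (n : A), add_sub_cancel_right, mul_assoc,
      ← pow_succ' a]

end Weyl

/-! ### The factorization of X^p - X over the prime field. -/

section Factors

variable (p : ℕ) [Fact p.Prime]

/-- The linear factors `X + i`, `1 ≤ i ≤ p`, of `X ^ p - X`. -/
def eulerFactor (i : Fin p) : (ZMod p)[X] := X + (((i : ℕ) + 1 : ℕ) : (ZMod p)[X])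

theorem eulerFactor_eq (i : Fin p) :
    eulerFactor p i = X - C (-(((i : ℕ) + 1 : ℕ) : ZMod p)) := by
  rw [eulerFactor, map_neg, sub_neg_eq_add, map_natCast]

theorem pairwise_isCoprime_eulerFactor :
    Pairwise (Function.onFun IsCoprime (eulerFactor p)) := by
  have hinj : Function.Injective fun i : Fin p => -(((i : ℕ) + 1 : ℕ) : ZMod p) := by
    intro i j hij
    have h := neg_injective hij
    rw [Nat.cast_succ, Nat.cast_succ, add_left_inj, ZMod.natCast_eq_natCast_iff] at h
    exact Fin.ext (h.eq_of_lt_of_lt i.2 j.2)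
  have := pairwise_coprime_X_sub_C hinj
  intro i j hij
  rw [Function.onFun, eulerFactor_eq, eulerFactor_eq]
  exact this hij

theorem prod_eulerFactor : ∏ i, eulerFactor p i = descPochhammer (ZMod p) p := by
  have h : ∀ n, descPochhammer (ZMod p) n = ∏ j ∈ Finset.range n, (X - (j : (ZMod p)[X])) := by
    intro n
    induction n with
    | zero => simp
    | succ n ih => rw [descPochhammer_succ_right, ih, Finset.prod_range_succ]
  have hp : (p : (ZMod p)[X]) = 0 := CharP.cast_eq_zero _ _
  -- Reversing the range pairs X - (p - 1 - i) with X + (i + 1); these agree because p = 0.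
  rw [h, ← Finset.prod_range_reflect, ← Fin.prod_univ_eq_prod_range]
  refine Finset.prod_congr rfl fun i _ => ?_
  have hi : (((p - 1 - i : ℕ) + (i + 1) : ℕ) : (ZMod p)[X]) = 0 := by
    rw [show p - 1 - i + (i + 1) = p by have := i.2; omega, hp]
  rw [Nat.cast_add] at hi
  rw [eulerFactor]
  linear_combination hi

end Factors

namespace DiffOp

theorem induction_on {R : Type*} [CommRing R] [Differential R] {P : DiffOp R → Prop}
    (L : DiffOp R) (hadd : ∀ L M, P L → P M → P (L + M))
    (hmon : ∀ a n, P (coef a * D ^ n)) : P L :=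
  Polynomial.induction_on' (motive := fun q => P (toPoly.symm q)) (toPoly L)
    (fun q r hq hr => by rw [map_add]; exact hadd _ _ hq hr)
    (fun n a => by rw [toPoly_symm_monomial]; exact hmon a n)

/-! ### Coprimality in a commutative subring and left ideals. -/

section LeftIdeal

variable {R : Type*} [CommRing R] [Differential R] {B : Type*} [CommRing B]

/-- Multiply T on the right by the Bézout relation aP + bQ = 1; in T·aP use T as a multiple of Q, in
T·bQ as a multiple of P. Commutativity of B makes this legitimate although T lies outside its image.
-/
theorem mem_leftIdeal_map_mul (φ : B →+* DiffOp R) {P Q : B} (h : IsCoprime P Q)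
    {T : DiffOp R} (hP : T ∈ leftIdeal (φ P)) (hQ : T ∈ leftIdeal (φ Q)) :
    T ∈ leftIdeal (φ (P * Q)) := by
  obtain ⟨a, b, hab⟩ := h
  obtain ⟨S, hS⟩ := mem_leftIdeal.mp hP
  obtain ⟨S', hS'⟩ := mem_leftIdeal.mp hQ
  refine mem_leftIdeal.mpr ⟨S' * φ a + S * φ b, ?_⟩
  calc T = T * φ (a * P + b * Q) := by rw [hab, map_one, mul_one]
    _ = T * φ (a * P) + T * φ (b * Q) := by rw [map_add, mul_add]
    _ = S' * φ Q * φ (a * P) + S * φ P * φ (b * Q) := by rw [← hS, ← hS']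
    _ = (S' * φ a + S * φ b) * φ (P * Q) := by
      rw [mul_assoc, mul_assoc, ← map_mul, ← map_mul, add_mul, mul_assoc, mul_assoc, ← map_mul,
        ← map_mul]
      ring_nf

theorem mem_leftIdeal_map_prod {ι : Type*} (φ : B →+* DiffOp R) {P : ι → B} (s : Finset ι)
    (h : Pairwise (Function.onFun IsCoprime P)) {T : DiffOp R}
    (hT : ∀ i ∈ s, T ∈ leftIdeal (φ (P i))) : T ∈ leftIdeal (φ (∏ i ∈ s, P i)) := by
  classical
  induction s using Finset.induction_on with
  | empty => exact mem_leftIdeal.mpr ⟨T, by simp⟩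
  | insert i s hi ih =>
    rw [Finset.prod_insert hi]
    refine mem_leftIdeal_map_mul φ (IsCoprime.prod_right fun j hj => h ?_)
      (hT i (Finset.mem_insert_self i s)) (ih fun j hj => hT j (Finset.mem_insert_of_mem hj))
    rintro rfl
    exact hi hj

theorem mem_leftIdeal_map_of_isCoprime (φ : B →+* DiffOp R) {u v w : B} (h : IsCoprime u v)
    {J : Submodule (DiffOp R) (DiffOp R)} (hu : φ (u * w) ∈ J) (hv : φ v ∈ J) : φ w ∈ J := by
  obtain ⟨a, b, hab⟩ := h
  have : w = a * (u * w) + (b * w) * v := by linear_combination (-w) * hab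
  rw [this, map_add, map_mul, map_mul _ (b * w)]
  exact J.add_mem (J.smul_mem _ hu) (J.smul_mem _ hv)

end LeftIdeal

/-! ### Polynomials in ∂^p. -/

section EvalDPow

variable {R : Type*} [CommRing R] [Differential R] {p : ℕ}

/-- Evaluation of polynomials at the central operator `∂^p`. -/
def evalDPow (hc : ∀ a : R, Commute (coef a) (D ^ p : DiffOp R)) : R[X] →+* DiffOp R :=
  eval₂RingHom' coef (D ^ p) hc

theorem evalDPow_X_sub_C (hc : ∀ a : R, Commute (coef a) (D ^ p : DiffOp R)) (y : R) :
    evalDPow hc (X - C y) = D ^ p - coef y := by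
  rw [map_sub]
  congr 1
  · exact eval₂_X _ _
  · exact eval₂_C _ _

end EvalDPow

/-! ### The p-th power of ∂ - f. -/

section Euler

variable {K : Type*} [Field K] [Differential K]

instance charP (p : ℕ) [CharP K p] : CharP (DiffOp K) p :=
  charP_of_injective_ringHom (coef (R := K)).injective p

theorem D_sub_coef_mul_coef (f a : K) :
    (D - coef f) * coef a = coef a * (D - coef f) + coef a′ := by
  rw [sub_mul, D_mul_coef, mul_sub, ← map_mul, ← map_mul, mul_comm f a]
  abel

theorem toPoly_D_sub_coef (f : K) : toPoly (D - coef f) = X - C f := by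
  rw [map_sub, toPoly_coef]
  rfl

theorem ord_D_sub_coef (f : K) : ord (D - coef f) = 1 := by
  rw [ord, toPoly_D_sub_coef, natDegree_X_sub_C]

theorem ne_zero_of_ord_ne_zero {L : DiffOp K} (h : ord L ≠ 0) : L ≠ 0 := by
  rintro rfl
  exact h (by rw [ord, map_zero, natDegree_zero])

theorem coeff_pow_of_natDegree_le_one {L : DiffOp K} (hL : ord L ≤ 1) (n : ℕ) :
    ord (L ^ n) ≤ n ∧ (toPoly (L ^ n)).coeff n = (toPoly L).coeff 1 ^ n := by
  induction n with
  | zero => rw [pow_zero, ord_one, toPoly_one, coeff_one_zero, pow_zero]; exact ⟨le_rfl, rfl⟩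
  | succ n ih =>
    rw [pow_succ, toPoly_mul, coeff_act ih.1 hL, ih.2, pow_succ]
    exact ⟨natDegree_act_le ih.1 hL, rfl⟩

/-- The commutator with x is formal differentiation with respect to ∂. -/
theorem commutator_coef {x : K} (hx : x′ = 1) (L : DiffOp K) :
    L * coef x = coef x * L + toPoly.symm (derivative (toPoly L)) := by
  have h : (D : DiffOp K) * coef x = coef x * D + 1 := by rw [D_mul_coef, hx, map_one]
  induction L using induction_on with
  | hadd L M hL hM => rw [add_mul, hL, hM, map_add, derivative_add, map_add, mul_add]; abel
  | hmon a n =>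
    have h1 : coef a * D ^ n = toPoly.symm (monomial n a) := (toPoly_symm_monomial n a).symm
    conv_rhs => rw [h1, LinearEquiv.apply_symm_apply, derivative_monomial, toPoly_symm_monomial,
      toPoly_symm_monomial, map_mul, map_natCast]
    rw [mul_assoc, pow_mul_of_mul_eq_mul_add_one h, mul_add, ← mul_assoc, ← mul_assoc,
      ← mul_assoc, ← map_mul, ← map_mul, mul_comm a x]

variable {p : ℕ} [CharP K p]

/-- The formal derivative in ∂ vanishes, and below order p no positive exponent is killed by the
characteristic. -/
theorem ord_eq_zero_of_commute {x : K} (hx : x′ = 1) {L : DiffOp K}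
    (h : L * coef x = coef x * L) (hL : ord L < p) : ord L = 0 := by
  by_contra h0
  have h1 := commutator_coef hx L
  rw [h, left_eq_add, LinearEquiv.map_eq_zero_iff] at h1
  have h2 := congrArg (fun q => coeff q (ord L - 1)) h1
  have h3 : ord L - 1 + 1 = ord L := by omega
  simp only [coeff_derivative, coeff_zero, ← Nat.cast_succ, Nat.succ_eq_add_one, h3] at h2
  rcases mul_eq_zero.mp h2 with h4 | h4
  · exact coeff_ord_ne_zero (ne_zero_of_ord_ne_zero h0) h4
  · exact h0 (Nat.eq_zero_of_dvd_of_lt ((CharP.cast_eq_zero_iff K p _).mp h4) hL)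

variable [Fact p.Prime]

/-- If `∂ - f` divides `∂^p - y` on the right, then `(∂ - f)^p = ∂^p - y`. -/
theorem D_sub_coef_pow_char {x : K} (hx : x′ = 1) {f y : K}
    (h : IsLeftMultiple (D ^ p - coef y) (D - coef f)) :
    (D - coef f) ^ p = D ^ p - coef y := by
  have hp := (Fact.out : p.Prime).pos
  -- The commutator of (∂ - g)^p with x is p(∂ - g)^{p-1} = 0; g = 0 covers ∂^p itself.
  have hcomm : ∀ g : K, (D - coef g) ^ p * coef x = coef x * (D - coef g) ^ p := by
    intro g
    have h1 : (D - coef g) * coef x = coef x * (D - coef g) + 1 := by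
      rw [D_sub_coef_mul_coef, hx, map_one]
    rw [pow_mul_of_mul_eq_mul_add_one h1, CharP.cast_eq_zero, zero_mul, add_zero]
  have hD := hcomm 0
  rw [map_zero, sub_zero] at hD
  -- Both p-th powers are monic of order p, so their difference drops in order and, commuting with
  -- x, is a scalar c.
  have hord : ord ((D - coef f) ^ p - D ^ p) < p := by
    have h1 := coeff_pow_of_natDegree_le_one (ord_D_sub_coef f).le p
    have h2 := coeff_pow_of_natDegree_le_one (ord_D (R := K)).le p
    have h3 : (toPoly (D - coef f)).coeff 1 = 1 := by
      rw [toPoly_D_sub_coef, coeff_sub, coeff_X_one, coeff_C_succ, sub_zero]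
    have h4 : (toPoly (D : DiffOp K)).coeff 1 = 1 := coeff_X_one
    rw [h3] at h1
    rw [h4] at h2
    refine lt_of_le_of_ne ((natDegree_sub_le _ _).trans (max_le h1.1 h2.1)) fun h5 => ?_
    have h6 : (toPoly ((D - coef f) ^ p - D ^ p)).coeff p = 0 := by
      rw [map_sub, coeff_sub, h1.2, h2.2, sub_self]
    exact coeff_ord_ne_zero (ne_zero_of_ord_ne_zero (h5.trans_ne hp.ne'))
      ((congrArg (toPoly _).coeff h5).trans h6)
  obtain ⟨c, h0⟩ : ∃ c, (D - coef f) ^ p - D ^ p = coef c := ⟨_, eq_coef_of_ord_eq_zero (ord_eq_zero_of_commute hx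
    (L := (D - coef f) ^ p - D ^ p) (by rw [sub_mul, mul_sub, hcomm f, hD]) hord)⟩
  obtain ⟨Q, hQ⟩ := h
  -- The scalar c + y is a left multiple of ∂ - f, which has order 1; hence the cofactor is zero.
  have h1 : coef (c + y) = ((D - coef f) ^ (p - 1) - Q) * (D - coef f) := by
    rw [sub_mul, ← pow_succ, Nat.sub_add_cancel hp, ← hQ, map_add, ← h0]
    abel
  have h2 : (D - coef f) ^ (p - 1) - Q = 0 := by
    by_contra h3
    have h4 := congrArg ord h1
    rw [ord_coef, ord_mul h3 (ne_zero_of_ord_ne_zero (by rw [ord_D_sub_coef]; exact one_ne_zero)),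
      ord_D_sub_coef] at h4
    omega
  have h3 : (D - coef f) ^ p = Q * (D - coef f) := by
    rw [← sub_eq_zero.mp h2, ← pow_succ, Nat.sub_add_cancel hp]
  rw [h3, hQ]

end Euler

/-! ### The factors δ + i of ∂^p - y, where δ = x(∂ - f). -/

section EulerOperator

variable {K : Type*} [Field K] [Differential K] {p : ℕ} {x y f : K}

theorem commute_D_pow_sub_coef (hy : y′ = 0) (hc : ∀ a : K, Commute (coef a) (D ^ p : DiffOp K))
    (L : DiffOp K) : Commute (D ^ p - coef y) L := by
  have h1 : Commute (D ^ p - coef y) (D : DiffOp K) := by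
    refine Commute.sub_left ((Commute.refl D).pow_left p) ?_
    change coef y * D = D * coef y
    rw [D_mul_coef, hy, map_zero, add_zero]
  have h2 : ∀ a, Commute (D ^ p - coef y) (coef a) := fun a =>
    (hc a).symm.sub_left (by
      change coef y * coef a = coef a * coef y
      rw [← map_mul, ← map_mul, mul_comm])
  induction L using induction_on with
  | hadd L M hL hM => exact hL.add_right hM
  | hmon a n => exact (h2 a).mul_right (h1.pow_right n)

theorem ne_zero_of_deriv_eq_one (hx : x′ = 1) : x ≠ 0 := by
  rintro rfl
  rw [map_zero] at hx
  exact zero_ne_one hx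

variable [Fact p.Prime] [CharP K p]

theorem evalPrimeField_eulerFactor (i : Fin p) :
    evalPrimeField p (coef x * (D - coef f)) (eulerFactor p i) =
      coef x * D - coef (x * f) + coef (((i : ℕ) + 1 : ℕ) : K) := by
  rw [eulerFactor, map_add, evalPrimeField_X, map_natCast, map_natCast, mul_sub, map_mul]

theorem ord_evalPrimeField_eulerFactor (hx : x ≠ 0) (i : Fin p) :
    ord (evalPrimeField p (coef x * (D - coef f)) (eulerFactor p i)) = 1 := by
  have h : evalPrimeField p (coef x * (D - coef f)) (eulerFactor p i) =
      coef x * (D - coef (f - x⁻¹ * (((i : ℕ) + 1 : ℕ) : K))) := by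
    rw [evalPrimeField_eulerFactor, mul_sub, ← map_mul, mul_sub, ← mul_assoc, mul_inv_cancel₀ hx,
      one_mul, map_sub, map_mul, map_natCast]
    abel
  have h1 : (coef x : DiffOp K) ≠ 0 := (_root_.map_ne_zero coef).mpr hx
  rw [h, ord_mul h1 (ne_zero_of_ord_ne_zero (by rw [ord_D_sub_coef]; exact one_ne_zero)),
    ord_coef, ord_D_sub_coef]

theorem evalPrimeField_eulerFactor_ne_zero (hx : x ≠ 0) (i : Fin p) :
    evalPrimeField p (coef x * (D - coef f)) (eulerFactor p i) ≠ 0 :=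
  ne_zero_of_ord_ne_zero (by rw [ord_evalPrimeField_eulerFactor hx]; exact one_ne_zero)

/-- The product of the factors is the falling factorial of length p, which evaluates to x^p (∂ -
f)^p; the powers separate because ∂^p - y is central. -/
theorem evalPrimeField_prod_eulerFactor_pow (hx : x′ = 1) (hy : y′ = 0)
    (hc : ∀ a : K, Commute (coef a) (D ^ p : DiffOp K))
    (hf : (D - coef f) ^ p = D ^ p - coef y) (n : ℕ) :
    evalPrimeField p (coef x * (D - coef f)) ((∏ i, eulerFactor p i) ^ n) =
      coef (x ^ p) ^ n * (D ^ p - coef y) ^ n := by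
  have h : (D - coef f) * coef x = coef x * (D - coef f) + 1 := by
    rw [D_sub_coef_mul_coef, hx, map_one]
  rw [prod_eulerFactor, map_pow, evalPrimeField_descPochhammer p h, hf, ← map_pow,
    (commute_D_pow_sub_coef hy hc _).symm.mul_pow]

theorem pow_mem_of_evalPrimeField_mem (hx : x′ = 1) (hy : y′ = 0)
    (hc : ∀ a : K, Commute (coef a) (D ^ p : DiffOp K))
    (hf : (D - coef f) ^ p = D ^ p - coef y) {n : ℕ} {J : Submodule (DiffOp K) (DiffOp K)}
    (h : evalPrimeField p (coef x * (D - coef f)) ((∏ i, eulerFactor p i) ^ n) ∈ J) :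
    (D ^ p - coef y) ^ n ∈ J := by
  have h1 := J.smul_mem (coef ((x ^ p)⁻¹ ^ n)) h
  rwa [smul_eq_mul, evalPrimeField_prod_eulerFactor_pow hx hy hc hf, ← mul_assoc, ← map_pow,
    ← map_mul, ← mul_pow, inv_mul_cancel₀ (pow_ne_zero p (ne_zero_of_deriv_eq_one hx)), one_pow,
    map_one, one_mul] at h1

theorem pow_mem_leftIdeal_of_dvd (hx : x′ = 1) (hy : y′ = 0)
    (hc : ∀ a : K, Commute (coef a) (D ^ p : DiffOp K))
    (hf : (D - coef f) ^ p = D ^ p - coef y) {n : ℕ} {P : (ZMod p)[X]}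
    (h : P ∣ (∏ i, eulerFactor p i) ^ n) :
    (D ^ p - coef y) ^ n ∈ leftIdeal (evalPrimeField p (coef x * (D - coef f)) P) := by
  refine pow_mem_of_evalPrimeField_mem hx hy hc hf ?_
  obtain ⟨Q, hQ⟩ := h
  rw [hQ, mul_comm, map_mul]
  exact mul_mem_leftIdeal _ (self_mem_leftIdeal _)

/-- `∂^p - y` has nilpotency index `m` on the quotient by `(x∂ - xf + i)^m`. -/
theorem X_sub_C_pow_dvd_of_evalDPow_mem (hx : x′ = 1) (hy : y′ = 0)
    (hc : ∀ a : K, Commute (coef a) (D ^ p : DiffOp K))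
    (hf : (D - coef f) ^ p = D ^ p - coef y) (i : Fin p) (m : ℕ) {μ : K[X]}
    (h : evalDPow hc μ ∈
      leftIdeal (evalPrimeField p (coef x * (D - coef f)) (eulerFactor p i ^ m))) :
    (X - C y) ^ m ∣ μ := by
  set J := leftIdeal (evalPrimeField p (coef x * (D - coef f)) (eulerFactor p i ^ m)) with hJ
  rcases eq_or_ne μ 0 with rfl | hμ
  · exact dvd_zero _
  obtain ⟨u, hu, hu'⟩ := μ.exists_eq_pow_rootMultiplicity_mul_and_not_dvd hμ y
  rcases le_or_gt m (μ.rootMultiplicity y) with hm | hm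
  · exact (pow_dvd_pow _ hm).trans ⟨u, hu⟩
  exfalso
  obtain ⟨n, rfl⟩ : ∃ n, m = n + 1 := ⟨m - 1, by omega⟩
  have hpow : evalDPow hc ((X - C y) ^ (n + 1)) ∈ J := by
    rw [map_pow, evalDPow_X_sub_C]
    exact pow_mem_leftIdeal_of_dvd hx hy hc hf
      (pow_dvd_pow_of_dvd (Finset.dvd_prod_of_mem _ (Finset.mem_univ i)) _)
  -- The cofactor u of the power of Y - y in μ is prime to Y - y, and (∂^p - y)^{n+1} is already in
  -- J, so u can be cancelled.
  have h1 : evalDPow hc ((X - C y) ^ μ.rootMultiplicity y) ∈ J := by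
    refine mem_leftIdeal_map_of_isCoprime _
      (isCoprime_X_sub_C_pow (mt dvd_iff_isRoot.mpr hu') (n + 1)).symm ?_ hpow
    rwa [mul_comm, ← hu]
  have h2 : (D ^ p - coef y) ^ n ∈ J := by
    rw [map_pow, evalDPow_X_sub_C] at h1
    rw [← Nat.sub_add_cancel (Nat.lt_succ_iff.mp hm), pow_add]
    exact mul_mem_leftIdeal _ h1
  have h3 : evalPrimeField p (coef x * (D - coef f)) ((∏ j, eulerFactor p j) ^ n) ∈ J := by
    rw [evalPrimeField_prod_eulerFactor_pow hx hy hc hf]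
    exact mul_mem_leftIdeal _ h2
  -- The factors with j ≠ i are coprime to δ + i and cancel modulo (δ + i)^{n+1}. What remains has
  -- order n, too small for a nonzero element of J.
  have h4 : evalPrimeField p (coef x * (D - coef f)) (eulerFactor p i ^ n) ∈ J := by
    refine mem_leftIdeal_map_of_isCoprime _ (u := (∏ j ∈ Finset.univ.erase i, eulerFactor p j) ^ n)
      (v := eulerFactor p i ^ (n + 1)) (IsCoprime.pow ?_) ?_ (self_mem_leftIdeal _)
    · exact IsCoprime.prod_left fun j hj =>
        pairwise_isCoprime_eulerFactor p (Finset.ne_of_mem_erase hj)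
    · rwa [← mul_pow, Finset.prod_erase_mul _ _ (Finset.mem_univ i)]
  have hx0 := ne_zero_of_deriv_eq_one hx
  have h5 := evalPrimeField_eulerFactor_ne_zero (f := f) hx0 i
  rw [map_pow] at h4
  have h6 := ord_le_of_mem_leftIdeal h4 (pow_ne_zero n h5)
  rw [map_pow, ord_pow h5, ord_pow h5, ord_evalPrimeField_eulerFactor hx0] at h6
  omega

end EulerOperator

/-! ### The annihilator in k[∂^p] and the p-curvature. -/

theorem commute_coef_D_pow_char {F : Type*} [Field F] (p : ℕ) [CharP F p] (a : RatFunc F) :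
    Commute (coef a) (D ^ p : DiffOp (RatFunc F)) := (D_pow_char_comm p a).symm

/-- The polynomials `μ` such that `μ(∂^p)` is a left multiple of `L`. -/
def annihilator {k : Type*} [CommRing k] [Differential k] {p : ℕ}
    (hc : ∀ a : k, Commute (coef a) (D ^ p : DiffOp k)) (L : DiffOp k) : Ideal k[X] where
  carrier := {μ | evalDPow hc μ ∈ leftIdeal L}
  add_mem' {a b} ha hb := by
    change evalDPow hc (a + b) ∈ leftIdeal L
    rw [map_add]
    exact add_mem ha hb
  zero_mem' := by
    change evalDPow hc 0 ∈ leftIdeal L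
    rw [map_zero]
    exact zero_mem _
  smul_mem' c a ha := by
    change evalDPow hc (c * a) ∈ leftIdeal L
    rw [map_mul]
    exact mul_mem_leftIdeal _ ha

theorem mem_annihilator {k : Type*} [CommRing k] [Differential k] {p : ℕ}
    {hc : ∀ a : k, Commute (coef a) (D ^ p : DiffOp k)} {L : DiffOp k} {μ : k[X]} :
    μ ∈ annihilator hc L ↔ evalDPow hc μ ∈ leftIdeal L := Iff.rfl

section PCurvature

variable {F : Type*} [Field F] {p : ℕ} [CharP F p]

theorem coef_smul_quot {L : DiffOp (RatFunc F)} (a : RatFunc F) (v : Quot L) :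
    coef a • v = a • v := by
  change (a • (1 : DiffOp (RatFunc F))) • v = a • v
  rw [smul_assoc, one_smul]

theorem aeval_pCurvature (L : DiffOp (RatFunc F)) (μ : (RatFunc F)[X]) (v : Quot L) :
    aeval (pCurvature p L) μ v = evalDPow (commute_coef_D_pow_char p) μ • v := by
  induction μ using Polynomial.induction_on' with
  | add a b ha hb => rw [map_add, LinearMap.add_apply, ha, hb, map_add, add_smul]
  | monomial n a =>
    have h1 : evalDPow (commute_coef_D_pow_char p) (monomial n a) =
        coef a * (D ^ p) ^ n := eval₂_monomial _ _
    have h2 : ∀ v : Quot L, ((pCurvature p L) ^ n) v = ((D ^ p) ^ n : DiffOp (RatFunc F)) • v := by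
      induction n with
      | zero => intro v; rw [pow_zero, pow_zero, one_smul]; rfl
      | succ n ih =>
        intro v
        rw [pow_succ', pow_succ', mul_smul, ← ih (eval₂_monomial _ _)]
        rfl
    rw [h1, mul_smul, coef_smul_quot, ← h2, aeval_monomial]
    rfl

/-- Cayley–Hamilton, evaluated at the class of 1. -/
theorem pCurvatureCharpoly_mem_annihilator (L : DiffOp (RatFunc F)) (hL : L ≠ 0) :
    pCurvatureCharpoly p L hL ∈ annihilator (commute_coef_D_pow_char p) L := by
  have := finite_quot L hL
  have h := aeval_pCurvature (p := p) L (pCurvature p L).charpoly (Submodule.Quotient.mk 1)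
  rw [LinearMap.aeval_self_charpoly, LinearMap.zero_apply, ← Submodule.Quotient.mk_smul,
    smul_eq_mul, mul_one] at h
  exact mem_annihilator.mpr ((Submodule.Quotient.mk_eq_zero (leftIdeal L)).mp h.symm)

theorem natDegree_pCurvatureCharpoly (L : DiffOp (RatFunc F)) (hL : L ≠ 0) :
    (pCurvatureCharpoly p L hL).natDegree = ord L := by
  have := finite_quot L hL
  rw [← finrank_quot L hL]
  exact LinearMap.charpoly_natDegree _

theorem monic_pCurvatureCharpoly (L : DiffOp (RatFunc F)) (hL : L ≠ 0) :
    (pCurvatureCharpoly p L hL).Monic := by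
  have := finite_quot L hL
  exact LinearMap.charpoly_monic _

/-- An operator of order `m deg f` whose annihilator is generated by `f^m` has `p`-curvature with
characteristic polynomial `f^m`. -/
theorem pCurvatureCharpoly_eq_pow {f : (RatFunc F)[X]} (hf : f.Monic) {m : ℕ}
    {L : DiffOp (RatFunc F)} (hL : L ≠ 0) (hord : ord L = m * f.natDegree)
    (h : ∀ μ ∈ annihilator (commute_coef_D_pow_char p) L, f ^ m ∣ μ) :
    pCurvatureCharpoly p L hL = f ^ m := by
  refine (eq_of_dvd_of_natDegree_le_of_leadingCoeff
    (h _ (pCurvatureCharpoly_mem_annihilator L hL)) ?_ ?_).symm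
  swap
  · rw [hf.pow m, monic_pCurvatureCharpoly L hL]
  rw [natDegree_pCurvatureCharpoly, hf.natDegree_pow, hord]

/-- The cofactor Q in L = QA has order 0, so it is a nonzero scalar and can be inverted. -/
theorem leftIdeal_le_of_ord_le {K : Type*} [Field K] [Differential K] {L A : DiffOp K} (hL : L ≠ 0)
    (h : L ∈ leftIdeal A) (hord : ord L ≤ ord A) : leftIdeal A ≤ leftIdeal L := by
  obtain ⟨Q, rfl⟩ := mem_leftIdeal.mp h
  have hQ := left_ne_zero_of_mul hL
  rw [ord_mul hQ (right_ne_zero_of_mul hL)] at hord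
  have hQ0 : ord Q = 0 := by omega
  rw [leftIdeal_le_leftIdeal]
  refine mem_leftIdeal.mpr ⟨coef ((toPoly Q).coeff 0)⁻¹, ?_⟩
  have h0 : (toPoly Q).coeff 0 ≠ 0 := hQ0 ▸ coeff_ord_ne_zero hQ
  rw [← mul_assoc]
  conv_rhs => rw [eq_coef_of_ord_eq_zero hQ0, toPoly_coef, coeff_C_zero, coef_inv_mul_coef h0,
    one_mul]

theorem mem_range_coef_of_one_mem {K : Type*} [Field K] [Differential K] {L : DiffOp K}
    (h : (1 : DiffOp K) ∈ leftIdeal L) : L ∈ Set.range (coef (R := K)) := by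
  have h1 := ord_le_of_mem_leftIdeal h one_ne_zero
  rw [ord_one, Nat.le_zero] at h1
  exact ⟨_, (eq_coef_of_ord_eq_zero h1).symm⟩

/-- An operator of order `m deg f` whose annihilator is generated by `f^m`, with `f` irreducible,
is indecomposable. -/
theorem isIndecomposable_of_annihilator {f : (RatFunc F)[X]} (hf : f.Monic) (hf' : Irreducible f)
    {m : ℕ} {L : DiffOp (RatFunc F)} (hL : L ≠ 0) (hord : ord L = m * f.natDegree)
    (h : ∀ μ ∈ annihilator (commute_coef_D_pow_char p) L, f ^ m ∣ μ) :
    L.IsIndecomposable := by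
  have hfm : f ^ m ∈ annihilator (commute_coef_D_pow_char p) L := by
    rw [← pCurvatureCharpoly_eq_pow hf hL hord h]
    exact pCurvatureCharpoly_mem_annihilator L hL
  -- If f^m divides the whole annihilator of A, the degree of its characteristic polynomial forces
  -- ord A ≥ ord L. Then A and L generate the same left ideal, which lies in that of B, and
  -- coprimality makes B a unit.
  have key : ∀ A B : DiffOp (RatFunc F), B ∉ Set.range (coef (R := RatFunc F)) →
      (1 : DiffOp (RatFunc F)) ∈ leftIdeal A ⊔ leftIdeal B →
      L ∈ leftIdeal A → L ∈ leftIdeal B →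
      ¬ ∀ μ ∈ annihilator (commute_coef_D_pow_char p) A, f ^ m ∣ μ := by
    intro A B hB hAB hLA hLB hA
    have hA0 : A ≠ 0 := by
      rintro rfl
      obtain ⟨Q, hQ⟩ := mem_leftIdeal.mp hLA
      exact hL (by rw [hQ, mul_zero])
    have h1 := natDegree_le_of_dvd (hA _ (pCurvatureCharpoly_mem_annihilator A hA0))
      (monic_pCurvatureCharpoly A hA0).ne_zero
    rw [natDegree_pCurvatureCharpoly, hf.natDegree_pow, ← hord] at h1
    have h2 := (leftIdeal_le_of_ord_le hL hLA h1).trans (leftIdeal_le_leftIdeal.mpr hLB)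
    rw [sup_eq_right.mpr h2] at hAB
    exact hB (mem_range_coef_of_one_mem hAB)
  rintro ⟨A, B, hA, hB, hAB, hLCLM⟩
  have hAB' : (1 : DiffOp (RatFunc F)) ∈ leftIdeal A ⊔ leftIdeal B :=
    hAB ▸ self_mem_leftIdeal 1
  have hinf : leftIdeal L = leftIdeal A ⊓ leftIdeal B := by
    ext M
    rw [hLCLM, Submodule.mem_iInf, Fin.forall_fin_two]
    rfl
  have hL' : L ∈ leftIdeal A ⊓ leftIdeal B := hinf ▸ self_mem_leftIdeal L
  -- The annihilator of a right divisor C of L is principal and contains f^m, so its generator is a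
  -- power of the irreducible f.
  have hgen : ∀ C : DiffOp (RatFunc F), L ∈ leftIdeal C → ∃ c ≤ m,
      annihilator (commute_coef_D_pow_char p) C = Ideal.span {f ^ c} := by
    intro C hC
    obtain ⟨g, hg⟩ := (IsPrincipalIdealRing.principal
      (annihilator (commute_coef_D_pow_char p) C)).principal
    have h1 : f ^ m ∈ annihilator (commute_coef_D_pow_char p) C :=
      leftIdeal_le_leftIdeal.mpr hC hfm
    rw [hg, Submodule.mem_span_singleton] at h1
    obtain ⟨c, hc, hgc⟩ := (dvd_prime_pow hf'.prime m).mp (dvd_iff_exists_eq_mul_left.mpr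
      (h1.imp fun _ h => h.symm))
    exact ⟨c, hc, hg.trans (Ideal.span_singleton_eq_span_singleton.mpr hgc)⟩
  obtain ⟨a, ha, hJA⟩ := hgen A hL'.1
  obtain ⟨b, hb, hJB⟩ := hgen B hL'.2
  have hmax : f ^ max a b ∈ annihilator (commute_coef_D_pow_char p) L := by
    rw [mem_annihilator, hinf]
    refine Submodule.mem_inf.mpr ⟨mem_annihilator.mp ?_, mem_annihilator.mp ?_⟩
    · rw [hJA, Ideal.mem_span_singleton]
      exact pow_dvd_pow f (le_max_left a b)
    · rw [hJB, Ideal.mem_span_singleton]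
      exact pow_dvd_pow f (le_max_right a b)
  -- f^{max a b} annihilates both quotients, hence 𝒟_L; so one of A, B carries the full exponent m.
  have hm : m ≤ max a b := (pow_dvd_pow_iff hf'.ne_zero hf'.not_isUnit).mp (h _ hmax)
  rcases le_max_iff.mp hm with h1 | h1
  · refine key A B hB hAB' hL'.1 hL'.2 fun μ hμ => ?_
    rw [hJA, Ideal.mem_span_singleton] at hμ
    exact (pow_dvd_pow f h1).trans hμ
  · refine key B A hA (sup_comm (leftIdeal A) _ ▸ hAB') hL'.2 hL'.1 fun μ hμ => ?_
    rw [hJB, Ideal.mem_span_singleton] at hμ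
    exact (pow_dvd_pow f h1).trans hμ

end PCurvature

/-! ### Bounds for the order of an LCLM. -/

section LCLM

variable {k : Type*} [Field k] [Differential k]

theorem IsLCLM.mem_leftIdeal {ι : Type*} {L : DiffOp k} {Ls : ι → DiffOp k} (h : IsLCLM L Ls)
    (i : ι) : L ∈ leftIdeal (Ls i) := by
  have h1 := self_mem_leftIdeal L
  rw [h] at h1
  exact Submodule.mem_iInf _ |>.mp h1 i

/-- The kernel of k⟨∂⟩ → ∏ 𝒟_{L_i} is the intersection of the left ideals, so 𝒟_L embeds in the
product. -/
theorem IsLCLM.ord_le {ι : Type*} [Fintype ι] {L : DiffOp k} {Ls : ι → DiffOp k}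
    (h : IsLCLM L Ls) (hL : L ≠ 0) (hLs : ∀ i, Ls i ≠ 0) : ord L ≤ ∑ i, ord (Ls i) := by
  have := finite_quot L hL
  have := fun i => finite_quot (Ls i) (hLs i)
  have hle : ∀ i, leftIdeal L ≤ leftIdeal (Ls i) := fun i =>
    leftIdeal_le_leftIdeal.mpr (h.mem_leftIdeal i)
  let φ : Quot L →ₗ[k] ∀ i, Quot (Ls i) :=
    LinearMap.pi fun i => (Submodule.factor (hle i)).restrictScalars k
  have hφ : Function.Injective φ := by
    rw [← LinearMap.ker_eq_bot, LinearMap.ker_eq_bot']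
    intro v hv
    obtain ⟨M, rfl⟩ := (leftIdeal L).mkQ_surjective v
    refine (Submodule.Quotient.mk_eq_zero _).mpr ?_
    rw [h, Submodule.mem_iInf]
    exact fun i => (Submodule.Quotient.mk_eq_zero _).mp (congrFun hv i)
  have h1 := LinearMap.finrank_le_finrank_of_injective hφ
  rwa [Module.finrank_pi_fintype, finrank_quot L hL,
    Finset.sum_congr rfl fun i _ => finrank_quot (Ls i) (hLs i)] at h1

/-- If `k⟨∂⟩` surjects onto `K⟨∂⟩ / K⟨∂⟩ P`, then the operators over `k` that are left multiples of
`P` have order at least `[K : k] ord P`. -/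
theorem finrank_mul_ord_le {K : Type*} [Field K] [Differential K] [Algebra k K]
    [DifferentialAlgebra k K] {L : DiffOp k} (hL : L ≠ 0) {P : DiffOp K} (hP : P ≠ 0)
    (h : baseChangeHom K L ∈ leftIdeal P)
    (hsurj : ∀ A : DiffOp K, ∃ Q : DiffOp k, A - baseChangeHom K Q ∈ leftIdeal P) :
    Module.finrank k K * ord P ≤ ord L := by
  let _ : Module k (Quot P) := Module.compHom _ (algebraMap k K)
  have : IsScalarTower k K (Quot P) := ⟨fun a b v => by
    rw [Algebra.smul_def, mul_smul]
    rfl⟩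
  -- Representatives of order < ord L suffice, since L itself dies modulo P; thus a space of
  -- k-dimension ord L maps onto one of k-dimension [K : k] ord P.
  let τ : degreeLT k (ord L) →ₗ[k] Quot P :=
    { toFun := fun q => Submodule.Quotient.mk (baseChangeHom K (toPoly.symm q.1))
      map_add' := fun q r => by
        rw [Submodule.coe_add, map_add, map_add]
        rfl
      map_smul' := fun a q => by
        have h1 : baseChangeHom K (toPoly.symm (a • q.1)) =
            algebraMap k K a • baseChangeHom K (toPoly.symm q.1) := by
          rw [map_smul, ← coef_mul, map_mul, baseChangeHom_coef, coef_mul]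
        rw [Submodule.coe_smul, h1]
        rfl }
  have hτ : Function.Surjective τ := by
    intro v
    obtain ⟨A, rfl⟩ := (leftIdeal P).mkQ_surjective v
    obtain ⟨Q, hQ⟩ := hsurj A
    obtain ⟨S, R, hSR, hR⟩ := exists_mul_add hL Q
    refine ⟨⟨toPoly R, hR⟩, ?_⟩
    refine ((Submodule.Quotient.eq (leftIdeal P)).mpr ?_ :
      (Submodule.Quotient.mk (baseChangeHom K R) : Quot P) = Submodule.Quotient.mk A)
    have h1 : baseChangeHom K R - A =
        -(A - baseChangeHom K Q) - baseChangeHom K S * baseChangeHom K L := by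
      rw [hSR, map_add, map_mul]
      abel
    rw [h1]
    exact sub_mem (neg_mem hQ) (mul_mem_leftIdeal _ h)
  have : Module.Finite k (degreeLT k (ord L)) := .equiv (degreeLTEquiv k (ord L)).symm
  have h1 := LinearMap.finrank_le_finrank_of_surjective hτ
  rwa [← Module.finrank_mul_finrank k K, finrank_quot P hP, (degreeLTEquiv k _).finrank_eq,
    Module.finrank_fin_fun] at h1

end LCLM

/-! ### Injectivity and base change of μ ↦ μ(∂^p). -/

theorem toPoly_evalDPow {R : Type*} [CommRing R] [Differential R] {p : ℕ}
    (hc : ∀ a : R, Commute (coef a) (D ^ p : DiffOp R)) (μ : R[X]) :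
    toPoly (evalDPow hc μ) = expand R p μ := by
  induction μ using Polynomial.induction_on' with
  | add a b ha hb => rw [map_add, map_add, ha, hb, map_add]
  | monomial n a =>
    have h : evalDPow hc (monomial n a) = coef a * (D ^ p) ^ n := eval₂_monomial _ _
    rw [h, ← pow_mul, ← toPoly_symm_monomial, LinearEquiv.apply_symm_apply, expand_monomial,
      mul_comm]

theorem eq_zero_of_evalDPow_eq_zero {R : Type*} [CommRing R] [Differential R] {p : ℕ}
    (hc : ∀ a : R, Commute (coef a) (D ^ p : DiffOp R)) (hp : 0 < p) {μ : R[X]}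
    (h : evalDPow hc μ = 0) : μ = 0 := by
  rw [← expand_eq_zero hp, ← toPoly_evalDPow hc, h, map_zero]

section BaseChange

variable {k K : Type*} [CommRing k] [Differential k] [CommRing K] [Differential K] [Algebra k K]
  [DifferentialAlgebra k K] {p : ℕ}

theorem baseChangeHom_evalDPow (hk : ∀ a : k, Commute (coef a) (D ^ p : DiffOp k))
    (hK : ∀ a : K, Commute (coef a) (D ^ p : DiffOp K)) (μ : k[X]) :
    baseChangeHom K (evalDPow hk μ) = evalDPow hK (μ.map (algebraMap k K)) := by
  induction μ using Polynomial.induction_on' with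
  | add a b ha hb => rw [map_add, map_add, ha, hb, Polynomial.map_add, map_add]
  | monomial n a =>
    have h1 : evalDPow hk (monomial n a) = coef a * (D ^ p) ^ n := eval₂_monomial _ _
    have h2 : evalDPow hK (monomial n (algebraMap k K a)) =
      coef (algebraMap k K a) * (D ^ p) ^ n := eval₂_monomial _ _
    rw [h1, map_monomial, h2, map_mul, map_pow, map_pow, baseChangeHom_coef, baseChangeHom_D]

/-- If `∂^p` is central over `k`, then it is central over `k[y]` for a constant `y`. -/
theorem commute_coef_D_pow_of_generated (hk : ∀ a : k, Commute (coef a) (D ^ p : DiffOp k))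
    {y : K} (hy : y′ = 0) (hgen : ∀ a : K, ∃ h : k[X], aeval y h = a) (a : K) :
    Commute (coef a) (D ^ p : DiffOp K) := by
  obtain ⟨h, rfl⟩ := hgen a
  induction h using Polynomial.induction_on' with
  | add a b ha hb => rw [map_add, map_add]; exact ha.add_left hb
  | monomial n c =>
    rw [aeval_monomial, map_mul, map_pow]
    refine Commute.mul_left ?_ (Commute.pow_left (Commute.pow_right ?_ p) n)
    · have := (hk c).map (baseChangeHom K)
      rwa [map_pow, baseChangeHom_coef, baseChangeHom_D] at this
    · change coef y * D = D * coef y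
      rw [D_mul_coef, hy, map_zero, add_zero]

end BaseChange

/-! ### Descent from K to k and the theorem for an abstract K = k[y]. -/

section Main

variable {k K : Type*} [Field k] [Differential k] [Field K] [Differential K] [Algebra k K]
  [DifferentialAlgebra k K] {p : ℕ} {x y f : K} {N : k[X]}

/-- Modulo a power of the central element `∂^p - y`, every operator over `K = k[y]` comes from an
operator over `k`. -/
theorem exists_sub_baseChangeHom_mem (hk : ∀ a : k, Commute (coef a) (D ^ p : DiffOp k))
    (hsep : N.Separable) (hNy : aeval y N = 0) (hgen : ∀ a : K, ∃ h : k[X], aeval y h = a)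
    (hy : y′ = 0) (hK : ∀ a : K, Commute (coef a) (D ^ p : DiffOp K)) {P : DiffOp K} {n : ℕ}
    (hP : (D ^ p - coef y) ^ n ∈ leftIdeal P) (A : DiffOp K) :
    ∃ Q : DiffOp k, A - baseChangeHom K Q ∈ leftIdeal P := by
  induction A using induction_on with
  | hadd A B hA hB =>
    obtain ⟨Q, hQ⟩ := hA
    obtain ⟨R, hR⟩ := hB
    refine ⟨Q + R, ?_⟩
    rw [map_add, add_sub_add_comm]
    exact add_mem hQ hR
  | hmon a j =>
    -- The coefficient a is replaced by H(∂^p) with H over k, where H(Y) ≡ a modulo (Y - y)^n.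
    -- Centrality of ∂^p - y then lets the error term pass through ∂^j.
    obtain ⟨H, S, hS⟩ := exists_X_sub_C_pow_dvd_sub_map hsep hNy hgen n (C a)
    have h1 : coef a - baseChangeHom K (evalDPow hk H) =
        evalDPow hK S * (D ^ p - coef y) ^ n := by
      have h2 : evalDPow hK (C a) = coef a := eval₂_C _ _
      rw [baseChangeHom_evalDPow hk hK, ← h2, ← map_sub, hS, mul_comm, map_mul, map_pow,
        evalDPow_X_sub_C]
    refine ⟨evalDPow hk H * D ^ j, ?_⟩
    rw [map_mul, map_pow, baseChangeHom_D, ← sub_mul, h1, mul_assoc,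
      ((commute_D_pow_sub_coef hy hK (D ^ j)).pow_left n).eq, ← mul_assoc]
    exact mul_mem_leftIdeal _ hP

variable [Fact p.Prime] [CharP K p]

theorem pow_dvd_of_mem_annihilator (hk : ∀ a : k, Commute (coef a) (D ^ p : DiffOp k))
    (hsep : N.Separable) (hNy : aeval y N = 0) (hmin : ∀ μ : k[X], aeval y μ = 0 → N ∣ μ)
    (hx : x′ = 1) (hy : y′ = 0) (hK : ∀ a : K, Commute (coef a) (D ^ p : DiffOp K))
    (hf : (D - coef f) ^ p = D ^ p - coef y) (i : Fin p) (m : ℕ) {L : DiffOp k}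
    (hL : baseChangeHom K L ∈
      leftIdeal (evalPrimeField p (coef x * (D - coef f)) (eulerFactor p i ^ m)))
    {μ : k[X]} (hμ : μ ∈ annihilator hk L) : N ^ m ∣ μ := by
  refine pow_dvd_of_X_sub_C_pow_dvd hsep hNy hmin m μ ?_
  refine X_sub_C_pow_dvd_of_evalDPow_mem hx hy hK hf i m ?_
  rw [← baseChangeHom_evalDPow hk hK]
  exact baseChangeHom_mem_leftIdeal K (mem_annihilator.mp hμ) hL

/-- Being a left multiple of each of the coprime factors (δ + i)^{m_i}, L is over K a left multiple
of their product, whose order is ∑ m_i; the surjection from k⟨∂⟩ supplies the factor [K : k]. -/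
theorem sum_mul_finrank_le_ord (hk : ∀ a : k, Commute (coef a) (D ^ p : DiffOp k))
    (hsep : N.Separable) (hNy : aeval y N = 0) (hgen : ∀ a : K, ∃ h : k[X], aeval y h = a)
    (hx : x′ = 1) (hy : y′ = 0) (hK : ∀ a : K, Commute (coef a) (D ^ p : DiffOp K))
    (hf : (D - coef f) ^ p = D ^ p - coef y) (m : Fin p → ℕ) {L : DiffOp k} (hL : L ≠ 0)
    (h : ∀ i, baseChangeHom K L ∈
      leftIdeal (evalPrimeField p (coef x * (D - coef f)) (eulerFactor p i ^ m i))) :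
    ∑ i, m i * Module.finrank k K ≤ ord L := by
  have hx0 := ne_zero_of_deriv_eq_one hx
  have hne : ∀ i, evalPrimeField p (coef x * (D - coef f)) (eulerFactor p i) ≠ 0 :=
    evalPrimeField_eulerFactor_ne_zero hx0
  have hprod : ∀ s : Finset (Fin p),
      evalPrimeField p (coef x * (D - coef f)) (∏ i ∈ s, eulerFactor p i ^ m i) ≠ 0 ∧
      ord (evalPrimeField p (coef x * (D - coef f)) (∏ i ∈ s, eulerFactor p i ^ m i)) =
        ∑ i ∈ s, m i := by
    intro s
    induction s using Finset.induction_on with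
    | empty => rw [Finset.prod_empty, map_one, ord_one]; exact ⟨one_ne_zero, rfl⟩
    | insert i s hi ih =>
      rw [Finset.prod_insert hi, Finset.sum_insert hi, map_mul, map_pow,
        ord_mul (pow_ne_zero _ (hne i)) ih.1, ih.2, ord_pow (hne i),
        ord_evalPrimeField_eulerFactor hx0, mul_one]
      exact ⟨mul_ne_zero (pow_ne_zero _ (hne i)) ih.1, rfl⟩
  obtain ⟨hP, hPord⟩ := hprod Finset.univ
  have hmem := mem_leftIdeal_map_prod (evalPrimeField p (coef x * (D - coef f)))
    (P := fun i => eulerFactor p i ^ m i) Finset.univ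
    (fun i j hij => (pairwise_isCoprime_eulerFactor p hij).pow) (fun i _ => h i)
  -- The exponent ∑ m_i is only a convenient common bound for the m_i.
  have hdvd : ∏ i, eulerFactor p i ^ m i ∣ (∏ i, eulerFactor p i) ^ ∑ i, m i := by
    rw [← Finset.prod_pow]
    exact Finset.prod_dvd_prod_of_dvd _ _ fun i _ =>
      pow_dvd_pow _ (Finset.single_le_sum (fun j _ => Nat.zero_le (m j)) (Finset.mem_univ i))
  have h1 := finrank_mul_ord_le hL hP hmem (exists_sub_baseChangeHom_mem hk hsep hNy hgen hy hK
    (pow_mem_leftIdeal_of_dvd hx hy hK hf hdvd))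
  rwa [hPord, mul_comm, Finset.sum_mul] at h1

end Main

/-- The theorem for an abstract differential field `K = F(t)[y]`. -/
theorem lclmDecomposition_of_generated {F : Type*} [Field F] {p : ℕ} [Fact p.Prime] [CharP F p]
    {K : Type*} [Field K] [Differential K] [Algebra (RatFunc F) K]
    [DifferentialAlgebra (RatFunc F) K] {N : (RatFunc F)[X]} (hN : N.Monic) (hirr : Irreducible N)
    (hsep : N.Separable) {x y f : K} (hx : x′ = 1) (hy : y′ = 0) (hNy : aeval y N = 0)
    (hmin : ∀ μ : (RatFunc F)[X], aeval y μ = 0 → N ∣ μ)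
    (hgen : ∀ a : K, ∃ h : (RatFunc F)[X], aeval y h = a)
    (hrank : Module.finrank (RatFunc F) K = N.natDegree)
    (hf : IsLeftMultiple (D ^ p - coef y) (D - coef f)) (m : Fin p → ℕ)
    (Ls : Fin p → DiffOp (RatFunc F)) (hLs_ne : ∀ i, Ls i ≠ 0)
    (hLs_mul : ∀ i, IsLeftMultiple ((Ls i).baseChange K)
      ((coef x * D - coef (x * f) + coef (((i : ℕ) + 1 : ℕ) : K)) ^ m i))
    (hLs_ord : ∀ i, (Ls i).ord = m i * N.natDegree)
    (L : DiffOp (RatFunc F)) (hL : IsLCLM L Ls) :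
    (∀ i, (Ls i).IsIndecomposable) ∧
    (∀ i, pCurvatureCharpoly p (Ls i) (hLs_ne i) = N ^ m i) ∧
    L ≠ 0 ∧ L.ord = ∑ i, (Ls i).ord := by
  have hcF : CharP (RatFunc F) p :=
    charP_of_injective_algebraMap (algebraMap F (RatFunc F)).injective p
  have hcK : CharP K p :=
    charP_of_injective_algebraMap (algebraMap (RatFunc F) K).injective p
  have hk : ∀ a : RatFunc F, Commute (coef a) (D ^ p : DiffOp (RatFunc F)) :=
    commute_coef_D_pow_char p
  have hK : ∀ a : K, Commute (coef a) (D ^ p : DiffOp K) :=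
    commute_coef_D_pow_of_generated hk hy hgen
  have hf' := D_sub_coef_pow_char hx hf
  have hmem : ∀ i, baseChangeHom K (Ls i) ∈
      leftIdeal (evalPrimeField p (coef x * (D - coef f)) (eulerFactor p i ^ m i)) := by
    intro i
    rw [map_pow, evalPrimeField_eulerFactor]
    exact mem_leftIdeal.mpr (hLs_mul i)
  have hann : ∀ i, ∀ μ ∈ annihilator (commute_coef_D_pow_char p) (Ls i), N ^ m i ∣ μ :=
    fun i μ hμ => pow_dvd_of_mem_annihilator hk hsep hNy hmin hx hy hK hf' i (m i) (hmem i) hμ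
  have hchar : ∀ i, pCurvatureCharpoly p (Ls i) (hLs_ne i) = N ^ m i := fun i =>
    pCurvatureCharpoly_eq_pow hN (hLs_ne i) (hLs_ord i) (hann i)
  have hL0 : L ≠ 0 := by
    rintro rfl
    -- A nonzero common left multiple: N^{∑ m_i}(∂^p) is a multiple of each N^{m_i}(∂^p), which lies
    -- in the left ideal of L_i.
    have h1 : evalDPow (commute_coef_D_pow_char p) (N ^ ∑ i, m i) ∈
        leftIdeal (0 : DiffOp (RatFunc F)) := by
      rw [hL, Submodule.mem_iInf]
      intro i
      have h2 := pCurvatureCharpoly_mem_annihilator (p := p) (Ls i) (hLs_ne i)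
      rw [hchar i] at h2
      exact mem_annihilator.mp (Ideal.mem_of_dvd _ (pow_dvd_pow N
        (Finset.single_le_sum (fun j _ => Nat.zero_le (m j)) (Finset.mem_univ i))) h2)
    obtain ⟨Q, hQ⟩ := mem_leftIdeal.mp h1
    exact (hN.pow _).ne_zero (eq_zero_of_evalDPow_eq_zero _ (Fact.out : p.Prime).pos
      (hQ.trans (mul_zero Q)))
  refine ⟨fun i => isIndecomposable_of_annihilator hN hirr (hLs_ne i) (hLs_ord i) (hann i),
    hchar, hL0, le_antisymm (hL.ord_le hL0 hLs_ne) ?_⟩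
  rw [Finset.sum_congr rfl fun i _ => hLs_ord i, ← hrank]
  exact sum_mul_finrank_le_ord hk hsep hNy hgen hx hy hK hf' m hL0 fun i =>
    baseChangeHom_mem_leftIdeal K (hL.mem_leftIdeal i) (hmem i)

end DiffOp

/-! ### Specialization to K_N. -/

section KN

variable {F : Type*} [Field F] {p : ℕ} (N : (constField F p)[X])

theorem KN.mk_eq_aeval (h : (RatFunc F)[X]) : KN.mk N h = aeval (KN.y N) h :=
  (AdjoinRoot.aeval_eq h).symm

end KN

theorem mainTheorem5 {F : Type*} [Field F] [Finite F] (p : ℕ) [Fact p.Prime] [CharP F p]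
    (N : (constField F p)[X]) (hN_monic : N.Monic) (hN_irr : Irreducible N)
    (hN_sep : N.Separable)
    (fN : KN N)
    (hfN : DiffOp.IsLeftMultiple (DiffOp.D ^ p - DiffOp.coef (KN.y N))
      (DiffOp.D - DiffOp.coef fN))
    (m : Fin p → ℕ) (Ls : Fin p → DiffOp (RatFunc F))
    (hLs_ne : ∀ i, Ls i ≠ 0)
    (hLs_mul : ∀ i, DiffOp.IsLeftMultiple ((Ls i).baseChange (KN N))
      ((DiffOp.coef (KN.x N) * DiffOp.D - DiffOp.coef (KN.x N * fN)
        + DiffOp.coef (((i : ℕ) + 1 : ℕ) : KN N)) ^ m i))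
    (hLs_ord : ∀ i, (Ls i).ord = m i * N.natDegree)
    (L : DiffOp (RatFunc F)) (hL : DiffOp.IsLCLM L Ls) :
    (∀ i, (Ls i).IsIndecomposable) ∧
    (∀ i, DiffOp.pCurvatureCharpoly p (Ls i) (hLs_ne i) =
      (N.map (algebraMap (constField F p) (RatFunc F))) ^ m i) ∧
    (L ≠ 0 ∧ L.ord = ∑ i, (Ls i).ord) ∧
    DiffOp.IsLCLMDecomposition L Ls := by
  have := constField.isPurelyInseparable (F := F) p
  have hirr := hN_sep.map_irreducible_of_isPurelyInseparable (E := RatFunc F) hN_irr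
  have hmonic := hN_monic.map (algebraMap (constField F p) (RatFunc F))
  have hfield : IsField (KN N) := by
    have : Fact (Irreducible (N.map (algebraMap (constField F p) (RatFunc F)))) := ⟨hirr⟩
    exact Field.toIsField (AdjoinRoot (N.map (algebraMap (constField F p) (RatFunc F))))
  -- The field structure is built on the existing ring structure, so the derivation and the algebra
  -- structure of K_N stay compatible with it.
  let _ : Field (KN N) := hfield.toField
  have hx : (KN.x N)′ = 1 := by
    rw [KN.x, deriv_algebraMap, ← RatFunc.algebraMap_X, RatFunc.deriv_algebraMap_poly, derivative_X,
      map_one, map_one]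
  have hy : (KN.y N)′ = 0 := by
    rw [KN.y, KN.deriv_mk, Differential.mapCoeffs_X, map_zero]
  have hrank : Module.finrank (RatFunc F) (KN N) =
      (N.map (algebraMap (constField F p) (RatFunc F))).natDegree :=
    (AdjoinRoot.powerBasis' hmonic).finrank
  have hker : ∀ μ : (RatFunc F)[X], aeval (KN.y N) μ = 0 ↔
      N.map (algebraMap (constField F p) (RatFunc F)) ∣ μ := fun μ => by
    rw [← KN.mk_eq_aeval]
    exact AdjoinRoot.mk_eq_zero
  have hgen : ∀ a : KN N, ∃ h : (RatFunc F)[X], aeval (KN.y N) h = a := fun a => by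
    obtain ⟨h, rfl⟩ := AdjoinRoot.mk_surjective a
    exact ⟨h, (KN.mk_eq_aeval N h).symm⟩
  obtain ⟨h1, h2, h3⟩ := DiffOp.lclmDecomposition_of_generated hmonic hirr
    (hN_sep.map (f := algebraMap (constField F p) (RatFunc F))) hx hy ((hker _).mpr dvd_rfl)
    (fun μ => (hker μ).mp) hgen hrank hfN m Ls hLs_ne hLs_mul
    (by rwa [hN_monic.natDegree_map]) L hL
  exact ⟨h1, h2, h3, h3.1, h1, hL, h3.2⟩

end
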